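/- Let $n\ge 1$. For $a\in\mathbb{R}^n$ and $b\in\mathbb{R}^{n-1}$ let $$B=B(a,b)=\begin{pmatrix} b_1 & & & a_1\\ & \ddots & & \vdots\\ & & b_{n-1} & a_{n-1}\\ 0&\cdots&0&a_n\end{pmatrix}$$ be the broken-arrow matrix. Let $D\subset\mathbb{R}^n\times\mathbb{R}^{n-1}$ be the set, of full Lebesgue measure, of all $(a,b)$ such that all $a_i$ and all $b_i$ are nonzero and the $|b_i|$ are pairwise distinct. For every $(a,b)\in D$ there is exactly one pair $(q,\sigma)\in S^{n-1}\times\mathbb{R}^n$ such that $\sigma_1\ge\dots\ge\sigma_n\ge 0$ are the singular values of $B$ and $q$, with all $q_i\ge 0$, is the bottom row of a right singular vector matrix of $B$; that is, $B=U\,\mathrm{diag}(\sigma)\,V^t$ with $U,V$ orthogonal and $q_i=V_{n,i}$. The map $g:D\to S^{n-1}\times\mathbb{R}^n$, $(a,b)\mapsto(q,\sigma)$, is continuously differentiable, and its Jacobian satisfies $$dq\,d\sigma=\frac{\prod_{i=1}^n q_i}{\prod_{i=1}^{n-1}|a_i|}\,da\,db,$$ where $dq$ is the surface-area element on the unit sphere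 $S^{n-1}\subset\mathbb{R}^n$ and $da$, $db$, $d\sigma$ are Lebesgue measures. Explicitly: at every point of $D$ the (unsigned) Jacobian of $g$, i.e. the square root of the Gram determinant of its partial derivatives, equals $\prod_{i=1}^n q_i/\prod_{i=1}^{n-1}|a_i|$; and for every measurable $S\subseteq D$ on which $g$ is injective, the measure of $g(S)$ under $dq\,d\sigma$ is $\int_S \prod_{i=1}^n q_i/\prod_{i=1}^{n-1}|a_i|\;da\,db$. -/

import Mathlib

open MeasureTheory
open scoped Matrix

/-- The parameters `(a, b)` of an `n × n` broken-arrow matrix, with `n = m + 1`: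
the last column `a ∈ ℝⁿ` and the first `n - 1` diagonal entries `b ∈ ℝⁿ⁻¹`. -/
abbrev BAParams (m : ℕ) : Type := (Fin (m + 1) → ℝ) × (Fin m → ℝ)

/-- The pairs `(q, σ)`: a point `q` of the unit sphere of Euclidean `ℝⁿ` and `σ ∈ ℝⁿ`, `n = m + 1`. -/
abbrev BATarget (m : ℕ) : Type :=
  Metric.sphere (0 : EuclideanSpace ℝ (Fin (m + 1))) 1 × (Fin (m + 1) → ℝ)

/-- The broken-arrow matrix: column `k < n` has the single entry `b k` on the diagonal,
and the last column is `a`. -/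
def brokenArrow {m : ℕ} (p : BAParams m) : Matrix (Fin (m + 1)) (Fin (m + 1)) ℝ :=
  Matrix.of fun i j =>
    Fin.snoc (α := fun _ => ℝ) (fun k : Fin m => if i = k.castSucc then p.2 k else 0) (p.1 i) j

/-- `σ` is the vector of singular values of the broken-arrow matrix, in decreasing order, and `q` is
the bottom row of a right singular vector matrix `V`, with nonnegative entries. -/
def IsSingularData {m : ℕ} (p : BAParams m) (y : BATarget m) : Prop :=
  (∀ k, 0 ≤ y.2 k) ∧ Antitone y.2 ∧ (∀ k, 0 ≤ y.1.1 k) ∧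
    ∃ U ∈ Matrix.orthogonalGroup (Fin (m + 1)) ℝ, ∃ V ∈ Matrix.orthogonalGroup (Fin (m + 1)) ℝ,
      brokenArrow p = U * Matrix.diagonal y.2 * Vᵀ ∧ ∀ k, y.1.1 k = V (Fin.last m) k

/-- The nondegenerate parameters: no entry of `a` or `b` vanishes and no two entries of `b` have the
same absolute value. The complement is a Lebesgue null set. -/
def baDomain (m : ℕ) : Set (BAParams m) :=
  {p | (∀ i, p.1 i ≠ 0) ∧ (∀ i, p.2 i ≠ 0) ∧ ∀ i j, i ≠ j → |p.2 i| ≠ |p.2 j|}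

/-- The map `g`, viewed as a map into the linear space `ℝⁿ × ℝⁿ` that contains `Sⁿ⁻¹ × ℝⁿ`. -/
def ambientMap {m : ℕ} (g : BAParams m → BATarget m) (p : BAParams m) :
    EuclideanSpace ℝ (Fin (m + 1)) × (Fin (m + 1) → ℝ) :=
  ((g p).1.1, (g p).2)

/-- The matrix of all partial derivatives `∂(q, σ) / ∂(a, b)`, of size `2n × (2n - 1)`. -/
noncomputable def partialsMatrix {m : ℕ} (g : BAParams m → BATarget m) (p : BAParams m) :
    Matrix (Fin (m + 1) ⊕ Fin (m + 1)) (Fin (m + 1) ⊕ Fin m) ℝ :=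
  Matrix.of fun i j =>
    let e : BAParams m :=
      Sum.elim (fun k => (Pi.single k 1, 0)) (fun k => (0, Pi.single k 1)) j
    let w := fderiv ℝ (ambientMap g) p e
    Sum.elim (fun k => w.1 k) (fun k => w.2 k) i

/-- The (unsigned) Jacobian of `g` as a map from `ℝ²ⁿ⁻¹` to the `(2n - 1)`-dimensional Riemannian
manifold `Sⁿ⁻¹ × ℝⁿ`: the square root of the Gram determinant of the partial derivatives, that is,
the factor by which `g` changes the volume element. -/
noncomputable def jacobianFactor {m : ℕ} (g : BAParams m → BATarget m) (p : BAParams m) : ℝ :=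
  Real.sqrt ((partialsMatrix g p)ᵀ * partialsMatrix g p).det

/-- The measure `dq dσ` on `Sⁿ⁻¹ × ℝⁿ`: surface area on the unit sphere times Lebesgue measure. -/
noncomputable def dqdσ (m : ℕ) : Measure (BATarget m) :=
  (volume : Measure (EuclideanSpace ℝ (Fin (m + 1)))).toSphere.prod volume

/-- The density `∏ qᵢ / ∏_{i < n} |aᵢ|`. -/
noncomputable def baDensity {m : ℕ} (g : BAParams m → BATarget m) (p : BAParams m) : ℝ :=
  (∏ k, (g p).1.1 k) / ∏ i : Fin m, |p.1 i.castSucc|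

/-!
Let `λⱼ = σⱼ²`, and let `P(s) = det (s - BᵀB) = ∏ⱼ (s - λⱼ)` and `Q(s) = ∏ₖ (s - bₖ²)` be the
characteristic polynomials of `BᵀB` and of its upper left `(n - 1) × (n - 1)` block. The bottom
right entry of the resolvent of `BᵀB` is `Q / P = ∑ⱼ qⱼ² / (s - λⱼ)`, so `(q, σ)` and the pair of
polynomials determine each other (`IsSVD.arrowPoly_eq`, `IsSVD.sqComb_eq`,
`eq_of_sqProd_eq_of_sqComb_eq`), while both polynomials are explicit in `(a, b)`. This gives the
uniqueness of `(q, σ)`; its existence is the spectral theorem for `BᵀB`.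

To obtain a map between spaces of equal dimension, a radius `r > 0` is added: the cone `G (b, r,
a) = (r q, σ)` satisfies `Ψ ∘ G = Φ` (`specMap_coneMap`), where `Ψ` (`specMap`) and `Φ`
(`arrowMap`) send `(x, σ)` with `x = r q`, and `(b, r, a)`, to the values of `(r² Q, P)` at `n`
fixed nodes. Both are polynomial and block triangular. If the nodes are the `λⱼ` of the base
point, the diagonal blocks of `Ψ'` are diagonal matrices, and those of `Φ'` are, up to diagonal
factors, the orthogonal matrices `Vᵀ` and `Uᵀ`, because the singular vectors are the Cauchy-like
vectors `V_{kj} = qⱼ aₖ bₖ / (λⱼ - bₖ²)` and `U_{kj} = qⱼ aₖ σⱼ / (λⱼ - bₖ²)`. So no determinant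
has to be expanded, and with `Q(λⱼ) = qⱼ² ∏_{l ≠ j} (λⱼ - λₗ)` the quotient is `|det G'| = rⁿ⁻¹ ∏
qⱼ / ∏ |aₖ|` (`abs_det_fderiv_coneMap`). As `Ψ'` is invertible, the inverse function theorem shows
that `G` is continuously differentiable (`contDiffAt_coneMap`).

At `r = 1` the radial column of `G'` is the unit vector `(q, 0)`, orthogonal to the other columns,
so that `|det G'|` is the square root of the Gram determinant of the partial derivatives of `g`
(`jacobianFactor_eq`). The image measure is computed by applying the change of variables formula
to `G` on `0 < r < 1`, since the surface measure of a subset of the sphere is `n` times the volume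
of the cone over it (`dqdσ_image`).
-/

/-! ### Relations between the singular vectors -/

/-- `B = U diag(σ) Vᵀ` is a singular value decomposition of the broken-arrow matrix, and `q` is the
bottom row of `V`. No sign or order is prescribed. -/
structure IsSVD {m : ℕ} (p : BAParams m) (q σ : Fin (m + 1) → ℝ)
    (U V : Matrix (Fin (m + 1)) (Fin (m + 1)) ℝ) : Prop where
  orthU : U ∈ Matrix.orthogonalGroup (Fin (m + 1)) ℝ
  orthV : V ∈ Matrix.orthogonalGroup (Fin (m + 1)) ℝ
  decomp : brokenArrow p = U * Matrix.diagonal σ * Vᵀ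
  row : ∀ k, q k = V (Fin.last m) k

lemma brokenArrow_mul_castSucc {m : ℕ} (p : BAParams m) (W : Matrix (Fin (m + 1)) (Fin (m + 1)) ℝ)
    (k : Fin m) (j : Fin (m + 1)) :
    (brokenArrow p * W) k.castSucc j
      = p.2 k * W k.castSucc j + p.1 k.castSucc * W (Fin.last m) j := by
  simp [Matrix.mul_apply, brokenArrow, Fin.sum_univ_castSucc]

lemma brokenArrow_mul_last {m : ℕ} (p : BAParams m) (W : Matrix (Fin (m + 1)) (Fin (m + 1)) ℝ)
    (j : Fin (m + 1)) :
    (brokenArrow p * W) (Fin.last m) j = p.1 (Fin.last m) * W (Fin.last m) j := by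
  have h (x : Fin m) : Fin.last m ≠ x.castSucc := (Fin.castSucc_lt_last x).ne'
  simp [Matrix.mul_apply, brokenArrow, Fin.sum_univ_castSucc, h]

lemma brokenArrow_transpose_mul_castSucc {m : ℕ} (p : BAParams m)
    (W : Matrix (Fin (m + 1)) (Fin (m + 1)) ℝ) (k : Fin m) (j : Fin (m + 1)) :
    ((brokenArrow p)ᵀ * W) k.castSucc j = p.2 k * W k.castSucc j := by
  simp [Matrix.mul_apply, brokenArrow]

lemma brokenArrow_transpose_mul_last {m : ℕ} (p : BAParams m)
    (W : Matrix (Fin (m + 1)) (Fin (m + 1)) ℝ) (j : Fin (m + 1)) :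
    ((brokenArrow p)ᵀ * W) (Fin.last m) j = ∑ i, p.1 i * W i j := by
  simp [Matrix.mul_apply, brokenArrow]

lemma det_brokenArrow {m : ℕ} (p : BAParams m) :
    (brokenArrow p).det = (∏ k, p.2 k) * p.1 (Fin.last m) := by
  rw [Matrix.det_of_isUpperTriangular]
  · simp [Fin.prod_univ_castSucc, brokenArrow]
  · intro i j hij
    induction j using Fin.lastCases with
    | last => exact absurd hij (Fin.le_last i).not_gt
    | cast k =>
      have : i ≠ k.castSucc := hij.ne'
      simp [brokenArrow, this]

namespace IsSVD

variable {m : ℕ} {p : BAParams m} {q σ : Fin (m + 1) → ℝ}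
  {U V : Matrix (Fin (m + 1)) (Fin (m + 1)) ℝ}

lemma mul_right (h : IsSVD p q σ U V) : brokenArrow p * V = U * Matrix.diagonal σ := by
  have : Vᵀ * V = 1 := by simpa using (Matrix.mem_orthogonalGroup_iff' _ ℝ).1 h.orthV
  rw [h.decomp, mul_assoc, this, mul_one]

lemma transpose_mul_left (h : IsSVD p q σ U V) :
    (brokenArrow p)ᵀ * U = V * Matrix.diagonal σ := by
  have : Uᵀ * U = 1 := by simpa using (Matrix.mem_orthogonalGroup_iff' _ ℝ).1 h.orthU
  rw [h.decomp, Matrix.transpose_mul, Matrix.transpose_mul, mul_assoc, mul_assoc, this]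
  simp

lemma right_castSucc (h : IsSVD p q σ U V) (k : Fin m) (j : Fin (m + 1)) :
    p.2 k * V k.castSucc j + p.1 k.castSucc * q j = σ j * U k.castSucc j := by
  have := congrFun (congrFun h.mul_right k.castSucc) j
  rw [brokenArrow_mul_castSucc, Matrix.mul_diagonal, ← h.row] at this
  linarith

lemma right_last (h : IsSVD p q σ U V) (j : Fin (m + 1)) :
    p.1 (Fin.last m) * q j = σ j * U (Fin.last m) j := by
  have := congrFun (congrFun h.mul_right (Fin.last m)) j
  rw [brokenArrow_mul_last, Matrix.mul_diagonal, ← h.row] at this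
  linarith

lemma left_castSucc (h : IsSVD p q σ U V) (k : Fin m) (j : Fin (m + 1)) :
    p.2 k * U k.castSucc j = σ j * V k.castSucc j := by
  have := congrFun (congrFun h.transpose_mul_left k.castSucc) j
  rw [brokenArrow_transpose_mul_castSucc, Matrix.mul_diagonal] at this
  linarith

lemma left_last (h : IsSVD p q σ U V) (j : Fin (m + 1)) :
    ∑ i, p.1 i * U i j = σ j * q j := by
  have := congrFun (congrFun h.transpose_mul_left (Fin.last m)) j
  rw [brokenArrow_transpose_mul_last, Matrix.mul_diagonal, ← h.row] at this
  linarith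

lemma sum_col_mul_col (h : IsSVD p q σ U V) (i j : Fin (m + 1)) :
    ∑ k : Fin m, V k.castSucc i * V k.castSucc j + q i * q j = if i = j then 1 else 0 := by
  have h1 : Vᵀ * V = 1 := by simpa using (Matrix.mem_orthogonalGroup_iff' _ ℝ).1 h.orthV
  have := congrFun (congrFun h1 i) j
  simpa [Matrix.mul_apply, Fin.sum_univ_castSucc, ← h.row, Matrix.one_apply] using this

lemma sum_row_mul_row (h : IsSVD p q σ U V) (i j : Fin (m + 1)) :
    ∑ k, V i k * V j k = if i = j then 1 else 0 := by
  have h1 : V * Vᵀ = 1 := by simpa using (Matrix.mem_orthogonalGroup_iff _ ℝ).1 h.orthV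
  have := congrFun (congrFun h1 i) j
  simpa [Matrix.mul_apply, Matrix.one_apply] using this

lemma sum_sq_row (h : IsSVD p q σ U V) : ∑ k, q k ^ 2 = 1 := by
  have := h.sum_row_mul_row (Fin.last m) (Fin.last m)
  simpa [← h.row, sq] using this

lemma sum_castSucc_mul_row (h : IsSVD p q σ U V) (i : Fin m) :
    ∑ k, V i.castSucc k * q k = 0 := by
  have := h.sum_row_mul_row i.castSucc (Fin.last m)
  simpa [← h.row, (Fin.castSucc_lt_last i).ne] using this

lemma sv_ne_zero (h : IsSVD p q σ U V) (hp : p ∈ baDomain m) (j : Fin (m + 1)) : σ j ≠ 0 := by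
  intro h0
  have h1 : (brokenArrow p).det = 0 := by
    rw [h.decomp, Matrix.det_mul, Matrix.det_mul, Matrix.det_diagonal,
      Finset.prod_eq_zero (Finset.mem_univ j) h0]
    simp
  rw [det_brokenArrow, mul_eq_zero, Finset.prod_eq_zero_iff] at h1
  rcases h1 with ⟨k, -, hk⟩ | h1
  · exact hp.2.1 k hk
  · exact hp.1 _ h1

/-- The eigenvalue equation of `BᵀB`, read off in the `k`-th coordinate. -/
lemma sub_mul_right (h : IsSVD p q σ U V) (k : Fin m) (j : Fin (m + 1)) :
    (σ j ^ 2 - p.2 k ^ 2) * V k.castSucc j = p.1 k.castSucc * p.2 k * q j := by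
  linear_combination -p.2 k * h.right_castSucc k j - σ j * h.left_castSucc k j

lemma row_ne_zero (h : IsSVD p q σ U V) (hp : p ∈ baDomain m) (j : Fin (m + 1)) : q j ≠ 0 := by
  intro hq
  have hcol := h.sum_col_mul_col j j
  simp only [hq, mul_zero, add_zero, if_true] at hcol
  obtain ⟨k, -, hk⟩ := Finset.exists_ne_zero_of_sum_ne_zero (hcol.trans_ne one_ne_zero)
  have hVk : V k.castSucc j ≠ 0 := fun h0 => hk (by simp [h0])
  have hbk : σ j ^ 2 = p.2 k ^ 2 := by
    have := h.sub_mul_right k j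
    simp only [hq, mul_zero, mul_eq_zero, hVk, or_false] at this
    linarith
  -- all the other entries of the `j`-th singular vectors vanish, as the `b i ^ 2` are distinct
  have hV (i : Fin m) (hi : i ≠ k) : V i.castSucc j = 0 := by
    have := h.sub_mul_right i j
    simp only [hq, mul_zero, mul_eq_zero] at this
    refine this.resolve_left fun h0 => hp.2.2 i k hi ?_
    rw [← sq_eq_sq_iff_abs_eq_abs]
    linarith
  have hU (i : Fin m) (hi : i ≠ k) : U i.castSucc j = 0 := by
    have := h.left_castSucc i j
    rw [hV i hi, mul_zero] at this
    exact (mul_eq_zero.1 this).resolve_left (hp.2.1 i)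
  have hUl : U (Fin.last m) j = 0 := by
    have := h.right_last j
    rw [hq, mul_zero] at this
    exact (mul_eq_zero.1 this.symm).resolve_left (h.sv_ne_zero hp j)
  have hl := h.left_last j
  rw [Fin.sum_univ_castSucc, hUl, hq, mul_zero, mul_zero, add_zero,
    Finset.sum_eq_single k (fun i _ hi => by rw [hU i hi, mul_zero]) (by simp)] at hl
  have hUk : U k.castSucc j = 0 := (mul_eq_zero.1 hl).resolve_left (hp.1 _)
  have := h.left_castSucc k j
  rw [hUk, mul_zero] at this
  exact hVk ((mul_eq_zero.1 this.symm).resolve_left (h.sv_ne_zero hp j))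

lemma sv_sq_ne (h : IsSVD p q σ U V) (hp : p ∈ baDomain m) (j : Fin (m + 1)) (k : Fin m) :
    σ j ^ 2 - p.2 k ^ 2 ≠ 0 := by
  intro h0
  have := h.sub_mul_right k j
  rw [h0, zero_mul] at this
  exact mul_ne_zero (mul_ne_zero (hp.1 _) (hp.2.1 k)) (h.row_ne_zero hp j) this.symm

lemma right_eq (h : IsSVD p q σ U V) (hp : p ∈ baDomain m) (j : Fin (m + 1)) (k : Fin m) :
    V k.castSucc j = q j * (p.1 k.castSucc * p.2 k / (σ j ^ 2 - p.2 k ^ 2)) := by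
  have := h.sub_mul_right k j
  field_simp [h.sv_sq_ne hp j k]
  linarith

lemma left_eq (h : IsSVD p q σ U V) (hp : p ∈ baDomain m) (j : Fin (m + 1)) (k : Fin m) :
    U k.castSucc j = q j * (p.1 k.castSucc * σ j / (σ j ^ 2 - p.2 k ^ 2)) := by
  have h1 := h.left_castSucc k j
  rw [h.right_eq hp] at h1
  apply mul_left_cancel₀ (hp.2.1 k)
  rw [h1]
  ring

lemma left_last_eq (h : IsSVD p q σ U V) (hp : p ∈ baDomain m) (j : Fin (m + 1)) :
    U (Fin.last m) j = q j * (p.1 (Fin.last m) / σ j) := by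
  have := h.right_last j
  field_simp [h.sv_ne_zero hp j]
  linarith

/-- Equal singular values would have proportional right singular vectors. -/
lemma sv_sq_injective (h : IsSVD p q σ U V) (hp : p ∈ baDomain m) :
    Function.Injective fun j => σ j ^ 2 := by
  intro i j hij
  by_contra hne
  have hi : q i ≠ 0 := h.row_ne_zero hp i
  have hj : q j ≠ 0 := h.row_ne_zero hp j
  have h1 := h.sum_col_mul_col i j
  have h2 := h.sum_col_mul_col j j
  simp only [if_neg hne, if_true] at h1 h2
  have h3 (k : Fin m) : V k.castSucc i = q i / q j * V k.castSucc j := by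
    rw [h.right_eq hp, h.right_eq hp]
    simp only at hij
    rw [hij]
    field_simp
  have h4 : q i / q j * (∑ k : Fin m, V k.castSucc j * V k.castSucc j + q j * q j) = 0 := by
    rw [← h1, mul_add, Finset.mul_sum]
    congr 1
    · refine Finset.sum_congr rfl fun k _ => ?_
      rw [h3 k, mul_assoc]
    · field_simp
  rw [h2, mul_one] at h4
  exact div_ne_zero hi hj h4

end IsSVD

/-! ### Existence of the singular value decomposition -/

lemma exists_isSingularData {m : ℕ} {p : BAParams m} (hp : p ∈ baDomain m) :
    ∃ y : BATarget m, IsSingularData p y := by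
  set B := brokenArrow p with hB
  have hdet : B.det ≠ 0 := by
    rw [hB, det_brokenArrow]
    exact mul_ne_zero (Finset.prod_ne_zero_iff.2 fun k _ => hp.2.1 k) (hp.1 _)
  have hpos : (Bᵀ * B).PosDef := by
    simpa using Matrix.PosDef.conjTranspose_mul_self B
      (Matrix.mulVec_injective_of_isUnit ((Matrix.isUnit_iff_isUnit_det B).2 hdet.isUnit))
  have hH : (Bᵀ * B).IsHermitian := hpos.1
  let W : Matrix (Fin (m + 1)) (Fin (m + 1)) ℝ := hH.eigenvectorUnitary
  have hW : Wᵀ * W = 1 := by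
    simpa using (Matrix.mem_orthogonalGroup_iff' _ ℝ).1 hH.eigenvectorUnitary.2
  have hspec : Bᵀ * B * W = W * Matrix.diagonal hH.eigenvalues := by
    ext i j
    have := congrFun (hH.mulVec_eigenvectorBasis j) i
    rw [Matrix.mul_diagonal]
    simpa [Matrix.mulVec, dotProduct, Matrix.mul_apply, W, mul_comm] using this
  -- sort the eigenvalues in decreasing order and make the bottom row of `V` nonnegative
  let e : Equiv.Perm (Fin (m + 1)) := Tuple.sort fun j => -hH.eigenvalues j
  let s : Fin (m + 1) → ℝ := fun j => if 0 ≤ W (Fin.last m) (e j) then 1 else -1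
  have hs (j) : s j * s j = 1 := by
    by_cases h : 0 ≤ W (Fin.last m) (e j) <;> simp [s, h]
  let ev : Fin (m + 1) → ℝ := fun j => hH.eigenvalues (e j)
  have hanti : Antitone ev := fun i j hij => neg_le_neg_iff.1
    (Tuple.monotone_sort (fun j => -hH.eigenvalues j) hij)
  have hev (j) : 0 < ev j := hpos.eigenvalues_pos _
  let σ : Fin (m + 1) → ℝ := fun j => √(ev j)
  have hσ (j) : 0 < σ j := Real.sqrt_pos.2 (hev j)
  have hσ2 (j) : σ j * σ j = ev j := Real.mul_self_sqrt (hev j).le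
  let V : Matrix (Fin (m + 1)) (Fin (m + 1)) ℝ := Matrix.of fun i j => W i (e j) * s j
  have hV1 : Vᵀ * V = 1 := by
    ext i j
    have h1 : (Vᵀ * V) i j = s i * s j * (Wᵀ * W) (e i) (e j) := by
      simp only [V, Matrix.mul_apply, Matrix.transpose_apply, Matrix.of_apply, Finset.mul_sum]
      exact Finset.sum_congr rfl fun k _ => by ring
    rw [h1, hW]
    by_cases hij : i = j
    · subst hij
      simp [hs, Matrix.one_apply_eq]
    · simp [hij]
  have hV2 : V * Vᵀ = 1 := mul_eq_one_comm.1 hV1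
  have hBV : Bᵀ * B * V = V * Matrix.diagonal ev := by
    ext i j
    have h1 : (Bᵀ * B * V) i j = (Bᵀ * B * W) i (e j) * s j := by
      rw [Matrix.mul_apply, Matrix.mul_apply, Finset.sum_mul]
      exact Finset.sum_congr rfl fun k _ => by simp [V, mul_assoc]
    rw [h1, hspec, Matrix.mul_diagonal, Matrix.mul_diagonal]
    simp only [V, ev, Matrix.of_apply]
    ring
  let U := B * V * Matrix.diagonal fun j => (σ j)⁻¹
  have hU : Uᵀ * U = 1 := by
    have : Uᵀ * U = Matrix.diagonal (fun j => (σ j)⁻¹) * (Vᵀ * (Bᵀ * B * V))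
        * Matrix.diagonal fun j => (σ j)⁻¹ := by
      simp only [U, Matrix.transpose_mul, Matrix.diagonal_transpose, mul_assoc]
    rw [this, hBV, ← mul_assoc Vᵀ, hV1, one_mul, Matrix.diagonal_mul_diagonal,
      Matrix.diagonal_mul_diagonal, ← Matrix.diagonal_one]
    congr 1
    ext j
    rw [← hσ2]
    field_simp [(hσ j).ne']
  have hUB : B = U * Matrix.diagonal σ * Vᵀ := by
    have : (Matrix.diagonal fun j => (σ j)⁻¹) * Matrix.diagonal σ = 1 := by
      rw [Matrix.diagonal_mul_diagonal, ← Matrix.diagonal_one]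
      congr 1
      ext j
      exact inv_mul_cancel₀ (hσ j).ne'
    simp only [U]
    rw [mul_assoc (B * V), this, mul_one, mul_assoc, hV2, mul_one]
  refine ⟨(⟨WithLp.toLp 2 fun k => V (Fin.last m) k, ?_⟩, σ), fun k => (hσ k).le,
    fun i j hij => Real.sqrt_le_sqrt (hanti hij), fun k => ?_, U,
    (Matrix.mem_orthogonalGroup_iff' _ ℝ).2 (by simpa using hU), V,
    (Matrix.mem_orthogonalGroup_iff' _ ℝ).2 (by simpa using hV1), hUB, fun k => rfl⟩
  · have := congrFun (congrFun hV2 (Fin.last m)) (Fin.last m)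
    rw [mem_sphere_zero_iff_norm, EuclideanSpace.norm_eq]
    simpa [Matrix.mul_apply, sq] using this
  · change 0 ≤ V (Fin.last m) k
    by_cases h : 0 ≤ W (Fin.last m) (e k)
    · simp [V, s, h]
    · simpa [V, s, h] using (not_le.1 h).le

/-! ### The characteristic polynomials -/

section SqProd

variable {n : ℕ}

/-- The polynomial function `∏ₗ (s - uₗ²)`. -/
def sqProd (u : Fin n → ℝ) (s : ℝ) : ℝ := ∏ l, (s - u l ^ 2)

/-- The polynomial function `∏ₗ (s - uₗ²)` without its `i`-th factor. -/
def sqProdErase (u : Fin n → ℝ) (i : Fin n) (s : ℝ) : ℝ :=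
  ∏ l ∈ Finset.univ.erase i, (s - u l ^ 2)

/-- The combination `∑ᵢ xᵢ² ∏_{l ≠ i} (s - uₗ²)`, whose quotient by `∏ₗ (s - uₗ²)` has the residues
`xᵢ²` at the poles `uᵢ²`. -/
def sqComb (x u : Fin n → ℝ) (s : ℝ) : ℝ := ∑ i, x i ^ 2 * sqProdErase u i s

lemma sub_mul_sqProdErase (u : Fin n → ℝ) (i : Fin n) (s : ℝ) :
    (s - u i ^ 2) * sqProdErase u i s = sqProd u s :=
  Finset.mul_prod_erase _ (fun l => s - u l ^ 2) (Finset.mem_univ i)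

lemma sqProdErase_eq_div {u : Fin n → ℝ} {i : Fin n} {s : ℝ} (h : s - u i ^ 2 ≠ 0) :
    sqProdErase u i s = sqProd u s / (s - u i ^ 2) := by
  rw [← sub_mul_sqProdErase u i]
  field_simp

lemma sqProd_apply_sq (u : Fin n → ℝ) (i : Fin n) : sqProd u (u i ^ 2) = 0 :=
  Finset.prod_eq_zero (Finset.mem_univ i) (sub_self _)

lemma sqProdErase_apply_sq_of_ne (u : Fin n → ℝ) {i j : Fin n} (h : j ≠ i) :
    sqProdErase u i (u j ^ 2) = 0 :=
  Finset.prod_eq_zero (Finset.mem_erase.2 ⟨h, Finset.mem_univ j⟩) (sub_self _)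

lemma sqProdErase_apply_sq_ne_zero {u : Fin n → ℝ} (hu : Function.Injective fun i => u i ^ 2)
    (i : Fin n) : sqProdErase u i (u i ^ 2) ≠ 0 :=
  Finset.prod_ne_zero_iff.2 fun _ hl => sub_ne_zero.2 fun h => (Finset.mem_erase.1 hl).1 (hu h).symm

lemma sqComb_apply_sq (x u : Fin n → ℝ) (j : Fin n) :
    sqComb x u (u j ^ 2) = x j ^ 2 * sqProdErase u j (u j ^ 2) := by
  rw [sqComb, Finset.sum_eq_single j _ (by simp)]
  intro i _ hi
  rw [sqProdErase_apply_sq_of_ne u hi.symm, mul_zero]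

open Polynomial in
/-- The monic polynomial `∏_{l ∈ A} (X - uₗ²)`. -/
noncomputable def sqPoly (u : Fin n → ℝ) (A : Finset (Fin n)) : ℝ[X] := ∏ l ∈ A, (X - C (u l ^ 2))

lemma sqPoly_monic (u : Fin n → ℝ) (A : Finset (Fin n)) : (sqPoly u A).Monic :=
  Polynomial.monic_prod_of_monic _ _ fun _ _ => Polynomial.monic_X_sub_C _

lemma degree_sqPoly (u : Fin n → ℝ) (A : Finset (Fin n)) : (sqPoly u A).degree = A.card := by
  rw [sqPoly, Polynomial.degree_prod, Finset.sum_congr rfl fun l _ => Polynomial.degree_X_sub_C _]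
  simp

lemma eval_sqPoly_univ (u : Fin n → ℝ) (s : ℝ) :
    (sqPoly u Finset.univ).eval s = sqProd u s := by
  simp [sqPoly, sqProd, Polynomial.eval_prod]

lemma eval_sqPoly_erase (u : Fin n → ℝ) (i : Fin n) (s : ℝ) :
    (sqPoly u (Finset.univ.erase i)).eval s = sqProdErase u i s := by
  simp [sqPoly, sqProdErase, Polynomial.eval_prod]

lemma degree_sqPoly_erase_lt (u : Fin n → ℝ) (i : Fin n) :
    (sqPoly u (Finset.univ.erase i)).degree < n := by
  rw [degree_sqPoly]
  have := Finset.card_erase_lt_of_mem (Finset.mem_univ i)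
  simpa using this

lemma degree_sub_lt_of_monic {P Q : Polynomial ℝ} (hP : P.Monic) (hQ : Q.Monic) {d : ℕ}
    (hPd : P.degree = d) (hQd : Q.degree = d) : (P - Q).degree < d := by
  rw [← hPd]
  exact Polynomial.degree_sub_lt_left (hPd.trans hQd.symm) hP.ne_zero
    (hP.leadingCoeff.trans hQ.leadingCoeff.symm)

lemma eq_zero_of_degree_lt_of_eval {t : Fin n → ℝ} (ht : Function.Injective t) {P : Polynomial ℝ}
    (hd : P.degree < n) (h : ∀ j, P.eval (t j) = 0) : P = 0 :=
  Polynomial.eq_zero_of_degree_lt_of_eval_index_eq_zero (s := Finset.univ) (v := t) ht.injOn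
    (by simpa using hd) fun j _ => h j

lemma sqProd_eq_of_eval {t : Fin n → ℝ} (ht : Function.Injective t) {u v : Fin n → ℝ}
    (h : ∀ j, sqProd u (t j) = sqProd v (t j)) (s : ℝ) : sqProd u s = sqProd v s := by
  have := eq_zero_of_degree_lt_of_eval ht (P := sqPoly u Finset.univ - sqPoly v Finset.univ)
    (degree_sub_lt_of_monic (sqPoly_monic _ _) (sqPoly_monic _ _)
      (by simp [degree_sqPoly]) (by simp [degree_sqPoly]))
    fun j => by simp [eval_sqPoly_univ, h]
  simpa [eval_sqPoly_univ, sub_eq_zero] using congrArg (Polynomial.eval s) this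

lemma sqComb_eq_of_eval {t : Fin n → ℝ} (ht : Function.Injective t) {x y u v : Fin n → ℝ}
    (h : ∀ j, sqComb x u (t j) = sqComb y v (t j)) (s : ℝ) : sqComb x u s = sqComb y v s := by
  have hev (x u : Fin n → ℝ) (s : ℝ) :
      (∑ i, x i ^ 2 • sqPoly u (Finset.univ.erase i)).eval s = sqComb x u s := by
    simp [Polynomial.eval_finsetSum, eval_sqPoly_erase, sqComb]
  have hdeg (x u : Fin n → ℝ) :
      ∑ i, x i ^ 2 • sqPoly u (Finset.univ.erase i) ∈ Polynomial.degreeLT ℝ n :=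
    Submodule.sum_mem _ fun i _ => Submodule.smul_mem _ _
      (Polynomial.mem_degreeLT.2 (degree_sqPoly_erase_lt u i))
  have := eq_zero_of_degree_lt_of_eval ht
    (Polynomial.mem_degreeLT.1 (Submodule.sub_mem _ (hdeg x u) (hdeg y v)))
    fun j => by rw [Polynomial.eval_sub, hev, hev, h, sub_self]
  have h2 := congrArg (Polynomial.eval s) this
  rw [Polynomial.eval_sub, hev, hev, Polynomial.eval_zero, sub_eq_zero] at h2
  exact h2

/-- Numerator and denominator of `∑ᵢ xᵢ² / (s - σᵢ²)` determine the poles and the residues. -/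
lemma eq_of_sqProd_eq_of_sqComb_eq {t : Fin n → ℝ} (ht : Function.Injective t)
    {x y u v : Fin n → ℝ} (hx : ∀ i, 0 < x i) (hy : ∀ i, 0 < y i) (hu : ∀ i, 0 < u i)
    (hv : ∀ i, 0 < v i) (hua : StrictAnti u) (hva : StrictAnti v)
    (h₁ : ∀ j, sqComb x u (t j) = sqComb y v (t j)) (h₂ : ∀ j, sqProd u (t j) = sqProd v (t j)) :
    x = y ∧ u = v := by
  have key {u v : Fin n → ℝ} (hu : ∀ i, 0 < u i) (hv : ∀ i, 0 < v i)
      (h₂ : ∀ j, sqProd u (t j) = sqProd v (t j)) : Set.range u ⊆ Set.range v := by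
    rintro _ ⟨i, rfl⟩
    have h0 : sqProd v (u i ^ 2) = 0 := by
      rw [← sqProd_eq_of_eval ht h₂, sqProd_apply_sq]
    obtain ⟨l, -, hl⟩ := Finset.prod_eq_zero_iff.1 h0
    exact ⟨l, ((sq_eq_sq₀ (hu i).le (hv l).le).1 (sub_eq_zero.1 hl)).symm⟩
  have huv : u = v := (hua.range_inj hva).1
    ((key hu hv h₂).antisymm (key hv hu fun j => (h₂ j).symm))
  subst huv
  refine ⟨funext fun j => ?_, rfl⟩
  have hinj : Function.Injective fun i => u i ^ 2 := fun i j hij =>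
    hua.injective ((sq_eq_sq₀ (hu i).le (hu j).le).1 hij)
  have h := sqComb_eq_of_eval ht h₁ (u j ^ 2)
  rw [sqComb_apply_sq, sqComb_apply_sq] at h
  exact (sq_eq_sq₀ (hx j).le (hy j).le).1
    (mul_right_cancel₀ (sqProdErase_apply_sq_ne_zero hinj j) h)

end SqProd

/-- The characteristic polynomial `det (s - BᵀB)` of the broken-arrow matrix `B`, expanded along
its last column and simplified by `(s - bₖ²) ∏_{l ≠ k} (s - bₗ²) = ∏ₗ (s - bₗ²)`. -/
def arrowPoly {m : ℕ} (p : BAParams m) (s : ℝ) : ℝ :=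
  s * sqProd p.2 s - p.1 (Fin.last m) ^ 2 * sqProd p.2 s
    - s * ∑ k : Fin m, p.1 k.castSucc ^ 2 * sqProdErase p.2 k s

lemma sq_injective_of_mem_baDomain {m : ℕ} {p : BAParams m} (hp : p ∈ baDomain m) :
    Function.Injective fun k => p.2 k ^ 2 := by
  intro i j hij
  by_contra hne
  exact hp.2.2 i j hne ((sq_eq_sq_iff_abs_eq_abs _ _).1 hij)

namespace IsSVD

variable {m : ℕ} {p : BAParams m} {q σ : Fin (m + 1) → ℝ}
  {U V : Matrix (Fin (m + 1)) (Fin (m + 1)) ℝ}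

lemma arrowPoly_sq (h : IsSVD p q σ U V) (hp : p ∈ baDomain m) (j : Fin (m + 1)) :
    arrowPoly p (σ j ^ 2) = 0 := by
  have hq := h.row_ne_zero hp j
  have hσ := h.sv_ne_zero hp j
  have h1 : ∑ k : Fin m, p.1 k.castSucc ^ 2 * sqProdErase p.2 k (σ j ^ 2)
      = sqProd p.2 (σ j ^ 2) / (q j * σ j) * ∑ k : Fin m, p.1 k.castSucc * U k.castSucc j := by
    rw [Finset.mul_sum]
    refine Finset.sum_congr rfl fun k _ => ?_
    have := h.sv_sq_ne hp j k
    rw [sqProdErase_eq_div this, h.left_eq hp]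
    field_simp
  have h2 := h.left_last j
  rw [Fin.sum_univ_castSucc, h.left_last_eq hp, ← eq_sub_iff_add_eq] at h2
  rw [arrowPoly, h1, h2]
  field_simp
  ring

/-- `det (s - BᵀB) = ∏ᵢ (s - σᵢ²)`. -/
lemma arrowPoly_eq (h : IsSVD p q σ U V) (hp : p ∈ baDomain m) (s : ℝ) :
    arrowPoly p s = sqProd σ s := by
  let Q := sqPoly p.2 Finset.univ
  let P := sqPoly σ Finset.univ
  let F := (Polynomial.X * Q - P) - p.1 (Fin.last m) ^ 2 • Q
    - ∑ k : Fin m, p.1 k.castSucc ^ 2 • (Polynomial.X * sqPoly p.2 (Finset.univ.erase k))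
  have hev (s : ℝ) : F.eval s = arrowPoly p s - sqProd σ s := by
    simp only [F, Q, P, Polynomial.eval_sub, Polynomial.eval_mul, Polynomial.eval_X,
      Polynomial.eval_smul, eval_sqPoly_univ, Polynomial.eval_finsetSum, eval_sqPoly_erase,
      smul_eq_mul, arrowPoly]
    have : ∑ k : Fin m, p.1 k.castSucc ^ 2 * (s * sqProdErase p.2 k s)
        = s * ∑ k : Fin m, p.1 k.castSucc ^ 2 * sqProdErase p.2 k s := by
      rw [Finset.mul_sum]
      exact Finset.sum_congr rfl fun k _ => by ring
    rw [this]
    ring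
  have hQ : Q.degree = m := by simp [Q, degree_sqPoly]
  have hF : F ∈ Polynomial.degreeLT ℝ (m + 1) := by
    refine Submodule.sub_mem _ (Submodule.sub_mem _ ?_ (Submodule.smul_mem _ _ ?_))
      (Submodule.sum_mem _ fun k _ => Submodule.smul_mem _ _ ?_) <;> rw [Polynomial.mem_degreeLT]
    · refine degree_sub_lt_of_monic (Polynomial.monic_X.mul (sqPoly_monic _ _)) (sqPoly_monic _ _)
        ?_ (by simp [degree_sqPoly])
      rw [Polynomial.degree_mul, hQ, Polynomial.degree_X, add_comm]
      norm_cast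
    · rw [hQ]
      exact_mod_cast Nat.lt_succ_self m
    · rw [Polynomial.degree_mul, Polynomial.degree_X, degree_sqPoly]
      have := Finset.card_erase_lt_of_mem (Finset.mem_univ k)
      rw [Finset.card_univ, Fintype.card_fin] at this
      exact_mod_cast (by omega : 1 + (Finset.univ.erase k).card < m + 1)
  have h0 := eq_zero_of_degree_lt_of_eval (h.sv_sq_injective hp) (Polynomial.mem_degreeLT.1 hF)
    fun j => by rw [hev, h.arrowPoly_sq hp, sqProd_apply_sq, sub_self]
  have := hev s
  rw [h0, Polynomial.eval_zero] at this
  linarith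

/-- `∑ᵢ qᵢ² / (s - σᵢ²)` is the bottom right entry of the resolvent of `BᵀB`, and its numerator is
the characteristic polynomial of the complementary minor `diag (b₁², …)`. At `s = b k ^ 2` it
vanishes because the rows of `V` are orthogonal. -/
lemma sqComb_eq (h : IsSVD p q σ U V) (hp : p ∈ baDomain m) (s : ℝ) :
    sqComb q σ s = sqProd p.2 s := by
  let Q := sqPoly p.2 Finset.univ
  let F := ∑ i, q i ^ 2 • (sqPoly σ (Finset.univ.erase i) - Q)
  have hev (s : ℝ) : F.eval s = sqComb q σ s - sqProd p.2 s := by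
    simp only [F, Q, Polynomial.eval_sub, Polynomial.eval_smul, eval_sqPoly_univ,
      Polynomial.eval_finsetSum, eval_sqPoly_erase, smul_eq_mul, sqComb, mul_sub,
      Finset.sum_sub_distrib]
    rw [← Finset.sum_mul, h.sum_sq_row, one_mul]
  have hF : F ∈ Polynomial.degreeLT ℝ m := by
    refine Submodule.sum_mem _ fun i _ => Submodule.smul_mem _ _ (Polynomial.mem_degreeLT.2 ?_)
    exact degree_sub_lt_of_monic (sqPoly_monic _ _) (sqPoly_monic _ _)
      (by simp [degree_sqPoly]) (by simp [degree_sqPoly])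
  have h0 := eq_zero_of_degree_lt_of_eval (sq_injective_of_mem_baDomain hp)
    (Polynomial.mem_degreeLT.1 hF) fun k => by
      rw [hev, sqProd_apply_sq, sub_zero]
      have ha := hp.1 k.castSucc
      have hb := hp.2.1 k
      have : sqComb q σ (p.2 k ^ 2)
          = -sqProd σ (p.2 k ^ 2) / (p.1 k.castSucc * p.2 k) * ∑ i, V k.castSucc i * q i := by
        rw [sqComb, Finset.mul_sum]
        refine Finset.sum_congr rfl fun i _ => ?_
        have h1 := h.sv_sq_ne hp i k
        have h2 : p.2 k ^ 2 - σ i ^ 2 ≠ 0 := by rwa [← neg_ne_zero, neg_sub]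
        rw [sqProdErase_eq_div h2, h.right_eq hp, ← neg_sub (p.2 k ^ 2)]
        field_simp
      rw [this, h.sum_castSucc_mul_row, mul_zero]
  have := hev s
  rw [h0, Polynomial.eval_zero] at this
  linarith

/-- The residue formula `∏ₖ (σⱼ² - bₖ²) = qⱼ² ∏_{l ≠ j} (σⱼ² - σₗ²)`. -/
lemma sqProd_sq (h : IsSVD p q σ U V) (hp : p ∈ baDomain m) (j : Fin (m + 1)) :
    sqProd p.2 (σ j ^ 2) = q j ^ 2 * sqProdErase σ j (σ j ^ 2) := by
  rw [← h.sqComb_eq hp, sqComb_apply_sq]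

end IsSVD

namespace IsSingularData

variable {m : ℕ} {p : BAParams m} {y : BATarget m}

lemma exists_isSVD (h : IsSingularData p y) : ∃ U V, IsSVD p (fun k => y.1.1 k) y.2 U V := by
  obtain ⟨-, -, -, U, hU, V, hV, hB, hr⟩ := h
  exact ⟨U, V, hU, hV, hB, hr⟩

lemma row_pos (h : IsSingularData p y) (hp : p ∈ baDomain m) (j) : 0 < y.1.1 j := by
  obtain ⟨U, V, hs⟩ := h.exists_isSVD
  exact (h.2.2.1 j).lt_of_ne' (hs.row_ne_zero hp j)

lemma sv_pos (h : IsSingularData p y) (hp : p ∈ baDomain m) (j) : 0 < y.2 j := by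
  obtain ⟨U, V, hs⟩ := h.exists_isSVD
  exact (h.1 j).lt_of_ne' (hs.sv_ne_zero hp j)

lemma sv_sq_injective (h : IsSingularData p y) (hp : p ∈ baDomain m) :
    Function.Injective fun j => y.2 j ^ 2 := by
  obtain ⟨U, V, hs⟩ := h.exists_isSVD
  exact hs.sv_sq_injective hp

lemma sv_strictAnti (h : IsSingularData p y) (hp : p ∈ baDomain m) : StrictAnti y.2 :=
  h.2.1.strictAnti_of_injective fun i j hij => h.sv_sq_injective hp (by simp only [hij])

lemma unique {y' : BATarget m} (hp : p ∈ baDomain m) (h : IsSingularData p y)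
    (h' : IsSingularData p y') : y = y' := by
  obtain ⟨U, V, hs⟩ := h.exists_isSVD
  obtain ⟨U', V', hs'⟩ := h'.exists_isSVD
  obtain ⟨h1, h2⟩ := eq_of_sqProd_eq_of_sqComb_eq (h.sv_sq_injective hp) (h.row_pos hp)
    (h'.row_pos hp) (h.sv_pos hp) (h'.sv_pos hp) (h.sv_strictAnti hp) (h'.sv_strictAnti hp)
    (fun j => (hs.sqComb_eq hp _).trans (hs'.sqComb_eq hp _).symm)
    (fun j => (hs.arrowPoly_eq hp _).symm.trans (hs'.arrowPoly_eq hp _))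
  refine Prod.ext (Subtype.ext ?_) h2
  ext k
  exact congrFun h1 k

end IsSingularData

/-! ### Determinants of block triangular derivatives -/

section Det

variable {ι κ : Type*} [Fintype ι] [Fintype κ]

lemma linearMap_det_prod [DecidableEq ι] [DecidableEq κ]
    (f : (ι → ℝ) × (κ → ℝ) →ₗ[ℝ] (ι → ℝ) × (κ → ℝ)) :
    LinearMap.det f = (Matrix.fromBlocks
      (Matrix.of fun j i => (f (Pi.single i 1, 0)).1 j)
      (Matrix.of fun j i => (f (0, Pi.single i 1)).1 j)
      (Matrix.of fun j i => (f (Pi.single i 1, 0)).2 j)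
      (Matrix.of fun j i => (f (0, Pi.single i 1)).2 j)).det := by
  rw [← LinearMap.det_toMatrix ((Pi.basisFun ℝ ι).prod (Pi.basisFun ℝ κ))]
  congr 1
  ext (i | i) (j | j) <;> simp [LinearMap.toMatrix_apply]

lemma fderiv_fst_apply_eq {E : Type*} [NormedAddCommGroup E] [NormedSpace ℝ E]
    {F : E → (ι → ℝ) × (κ → ℝ)} {w : E} (hF : DifferentiableAt ℝ F w) {e : E} {j : ι} {d : ℝ}
    (h : HasDerivAt (fun s : ℝ => (F (w + s • e)).1 j) d 0) : (fderiv ℝ F w e).1 j = d := by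
  have h1 := hF.hasFDerivAt.hasLineDerivAt e
  have h2 := ((ContinuousLinearMap.proj (R := ℝ) (φ := fun _ : ι => ℝ) j).comp
    (ContinuousLinearMap.fst ℝ (ι → ℝ) (κ → ℝ))).hasFDerivAt.comp_hasDerivAt (0 : ℝ) h1
  exact h2.unique h

lemma fderiv_snd_apply_eq {E : Type*} [NormedAddCommGroup E] [NormedSpace ℝ E]
    {F : E → (ι → ℝ) × (κ → ℝ)} {w : E} (hF : DifferentiableAt ℝ F w) {e : E} {j : κ} {d : ℝ}
    (h : HasDerivAt (fun s : ℝ => (F (w + s • e)).2 j) d 0) : (fderiv ℝ F w e).2 j = d := by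
  have h1 := hF.hasFDerivAt.hasLineDerivAt e
  have h2 := ((ContinuousLinearMap.proj (R := ℝ) (φ := fun _ : κ => ℝ) j).comp
    (ContinuousLinearMap.snd ℝ (ι → ℝ) (κ → ℝ))).hasFDerivAt.comp_hasDerivAt (0 : ℝ) h1
  exact h2.unique h

lemma abs_det_of_mem_orthogonalGroup [DecidableEq ι] {U : Matrix ι ι ℝ}
    (hU : U ∈ Matrix.orthogonalGroup ι ℝ) :
    |U.det| = 1 := by
  have h := congrArg Matrix.det ((Matrix.mem_orthogonalGroup_iff _ ℝ).1 hU)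
  rw [Matrix.det_mul, Matrix.det_one, Matrix.det_transpose, ← abs_mul_abs_self] at h
  nlinarith [abs_nonneg U.det]

end Det

/-! ### Partial derivatives -/

section PartialDeriv

variable {n : ℕ}

lemma hasDerivAt_sq_add (c d : ℝ) :
    HasDerivAt (fun s : ℝ => (c + s * d) ^ 2) (2 * c * d) 0 := by
  have := (((hasDerivAt_id (0 : ℝ)).mul_const d).const_add c).pow 2
  exact this.congr_deriv (by simp [mul_assoc])

lemma hasDerivAt_sqProd (u : Fin n → ℝ) (i : Fin n) (t : ℝ) :
    HasDerivAt (fun s : ℝ => sqProd (u + s • Pi.single i 1) t)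
      (-2 * u i * sqProdErase u i t) 0 := by
  have h : (fun s : ℝ => sqProd (u + s • Pi.single i 1) t)
      = fun s => (t - (u i + s * 1) ^ 2) * sqProdErase u i t := by
    funext s
    rw [← sub_mul_sqProdErase _ i]
    congr 1
    · simp
    · refine Finset.prod_congr rfl fun l hl => ?_
      simp [Pi.single_eq_of_ne (Finset.mem_erase.1 hl).1]
  rw [h]
  exact (((hasDerivAt_sq_add (u i) 1).const_sub t).mul_const (sqProdErase u i t)).congr_deriv
    (by ring)

lemma hasDerivAt_sum_sq_mul (x c : Fin n → ℝ) (i : Fin n) :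
    HasDerivAt (fun s : ℝ => ∑ l, (x + s • (Pi.single i 1 : Fin n → ℝ)) l ^ 2 * c l)
      (2 * x i * c i) 0 := by
  have h := HasDerivAt.fun_sum (u := Finset.univ) fun l (_ : l ∈ Finset.univ) =>
    (hasDerivAt_sq_add (x l) (Pi.single (M := fun _ => ℝ) i 1 l)).mul_const (c l)
  refine h.congr_deriv ?_
  rw [Finset.sum_eq_single i (fun l _ hl => by simp [Pi.single_eq_of_ne hl]) (by simp)]
  simp

end PartialDeriv

/-! ### The polynomial system -/

section System

variable {m : ℕ}

/-- Numerator and denominator of `∑ᵢ xᵢ² / (s - σᵢ²)`, evaluated at the nodes `tⱼ`. -/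
def specMap (t : Fin (m + 1) → ℝ) (w : (Fin (m + 1) → ℝ) × (Fin (m + 1) → ℝ)) :
    (Fin (m + 1) → ℝ) × (Fin (m + 1) → ℝ) :=
  (fun j => sqComb w.1 w.2 (t j), fun j => sqProd w.2 (t j))

/-- The parameters `(a, b)` contained in `((b, r), a)`, where `r` is the last entry of the first
vector. -/
def toParams (w : (Fin (m + 1) → ℝ) × (Fin (m + 1) → ℝ)) : BAParams m :=
  (w.2, fun k => w.1 k.castSucc)

/-- In the coordinates `((b, r), a)`: the polynomials `r² ∏ₖ (s - bₖ²)` and `det (s - BᵀB)`,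
evaluated at the nodes `tⱼ`. -/
def arrowMap (t : Fin (m + 1) → ℝ) (w : (Fin (m + 1) → ℝ) × (Fin (m + 1) → ℝ)) :
    (Fin (m + 1) → ℝ) × (Fin (m + 1) → ℝ) :=
  (fun j => w.1 (Fin.last m) ^ 2 * sqProd (toParams w).2 (t j),
    fun j => arrowPoly (toParams w) (t j))

lemma contDiff_specMap (t : Fin (m + 1) → ℝ) : ContDiff ℝ 1 (specMap t) := by
  unfold specMap sqComb sqProd sqProdErase
  fun_prop

lemma contDiff_arrowMap (t : Fin (m + 1) → ℝ) : ContDiff ℝ 1 (arrowMap t) := by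
  unfold arrowMap arrowPoly sqProd sqProdErase toParams
  fun_prop

/-- With the squares `σⱼ²` themselves as nodes, both diagonal blocks of the derivative are
diagonal matrices. -/
lemma abs_det_fderiv_specMap (x σ : Fin (m + 1) → ℝ) :
    |(fderiv ℝ (specMap fun j => σ j ^ 2) (x, σ)).det|
      = ∏ j, (4 * |x j| * |σ j| * sqProdErase σ j (σ j ^ 2) ^ 2) := by
  set t : Fin (m + 1) → ℝ := fun j => σ j ^ 2
  have hd : DifferentiableAt ℝ (specMap t) (x, σ) :=
    (contDiff_specMap t).differentiable one_ne_zero _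
  have h11 : (Matrix.of fun j i => (fderiv ℝ (specMap t) (x, σ) (Pi.single i 1, 0)).1 j)
      = Matrix.diagonal fun j => 2 * x j * sqProdErase σ j (σ j ^ 2) := by
    ext j i
    refine (fderiv_fst_apply_eq hd ?_).trans (b := 2 * x i * sqProdErase σ i (t j)) ?_
    · have := hasDerivAt_sum_sq_mul x (fun l => sqProdErase σ l (t j)) i
      simpa [specMap, sqComb] using this
    · by_cases hij : j = i
      · simp [hij, t]
      · simp [hij, t, sqProdErase_apply_sq_of_ne σ hij]
  have h21 (i j) : (fderiv ℝ (specMap t) (x, σ) (Pi.single i 1, 0)).2 j = 0 :=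
    fderiv_snd_apply_eq hd (by simpa [specMap] using hasDerivAt_const _ _)
  have h22 : (Matrix.of fun j i => (fderiv ℝ (specMap t) (x, σ) (0, Pi.single i 1)).2 j)
      = Matrix.diagonal fun j => -2 * σ j * sqProdErase σ j (σ j ^ 2) := by
    ext j i
    refine (fderiv_snd_apply_eq hd ?_).trans (b := -2 * σ i * sqProdErase σ i (t j)) ?_
    · simpa [specMap] using hasDerivAt_sqProd σ i (t j)
    · by_cases hij : j = i
      · simp [hij, t]
      · simp [hij, t, sqProdErase_apply_sq_of_ne σ hij]
  rw [ContinuousLinearMap.det, linearMap_det_prod]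
  simp only [ContinuousLinearMap.coe_coe, h11, h21, h22]
  have h0 : (Matrix.of fun (_ _ : Fin (m + 1)) => (0 : ℝ)) = 0 := rfl
  rw [h0, Matrix.det_fromBlocks_zero₂₁, Matrix.det_diagonal, Matrix.det_diagonal,
    ← Finset.prod_mul_distrib, Finset.abs_prod]
  refine Finset.prod_congr rfl fun j _ => ?_
  rw [← sq_abs (sqProdErase σ j (σ j ^ 2))]
  simp only [abs_mul, abs_neg, abs_two]
  ring

/-- With the squared singular values as nodes, the diagonal blocks of the derivative are the
matrices `V` and `U` of singular vectors, up to diagonal factors. -/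
lemma IsSVD.abs_det_fderiv_arrowMap {w : (Fin (m + 1) → ℝ) × (Fin (m + 1) → ℝ)}
    {q σ : Fin (m + 1) → ℝ} {U V : Matrix (Fin (m + 1)) (Fin (m + 1)) ℝ}
    (h : IsSVD (toParams w) q σ U V) (hp : toParams w ∈ baDomain m) :
    |(fderiv ℝ (arrowMap fun j => σ j ^ 2) w).det|
      = (∏ j, (4 * |σ j| * q j ^ 2 * sqProdErase σ j (σ j ^ 2) ^ 2))
        * (|w.1 (Fin.last m)| ^ (2 * m + 1) / ∏ k : Fin m, |w.2 k.castSucc|) := by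
  set t : Fin (m + 1) → ℝ := fun j => σ j ^ 2
  set Q : Fin (m + 1) → ℝ := fun j => sqProd (toParams w).2 (t j)
  set r := w.1 (Fin.last m)
  have hd : DifferentiableAt ℝ (arrowMap t) w :=
    (contDiff_arrowMap t).differentiable one_ne_zero _
  have hsplit (k : Fin m) (s : ℝ) :
      (toParams (w + (s • Pi.single k.castSucc 1, (0 : Fin (m + 1) → ℝ)))).2
        = (toParams w).2 + s • Pi.single k 1 := by
    ext l
    simp [toParams, Pi.single_apply]
  have hsplit' (s : ℝ) :
      (toParams (w + (s • Pi.single (Fin.last m) 1, (0 : Fin (m + 1) → ℝ)))).2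
        = (toParams w).2 := by
    ext l
    simp [toParams]
  have h11 : (Matrix.of fun j i => (fderiv ℝ (arrowMap t) w (Pi.single i 1, 0)).1 j)
      = Matrix.diagonal (fun j => 2 * Q j / q j) * Vᵀ
        * Matrix.diagonal (Fin.snoc (α := fun _ => ℝ) (fun k => -r ^ 2 / w.2 k.castSucc) r) := by
    ext j i
    rw [Matrix.mul_diagonal, Matrix.diagonal_mul, Matrix.of_apply, Matrix.transpose_apply]
    have hq := h.row_ne_zero hp j
    induction i using Fin.lastCases with
    | last =>
      rw [← h.row, Fin.snoc_last]
      refine (fderiv_fst_apply_eq hd ?_).trans (b := 2 * r * Q j) (by field_simp)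
      simpa [arrowMap, hsplit', Q, r] using (hasDerivAt_sq_add r 1).mul_const (Q j)
    | cast k =>
      have ha : w.2 k.castSucc ≠ 0 := hp.1 k.castSucc
      have hs := h.sv_sq_ne hp j k
      rw [Fin.snoc_castSucc, h.right_eq hp]
      refine (fderiv_fst_apply_eq hd ?_).trans
        (b := r ^ 2 * (-2 * (toParams w).2 k * sqProdErase (toParams w).2 k (t j))) ?_
      · have := (hasDerivAt_sqProd (toParams w).2 k (t j)).const_mul (r ^ 2)
        simpa [arrowMap, hsplit, r, (Fin.castSucc_lt_last k).ne'] using this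
      · rw [sqProdErase_eq_div hs]
        simp only [Q, t]
        change _ = _ * (_ * (w.2 k.castSucc * _ / _)) * _
        field_simp
  have h12 (i j) : (fderiv ℝ (arrowMap t) w (0, Pi.single i 1)).1 j = 0 :=
    fderiv_fst_apply_eq hd (by simpa [arrowMap, toParams] using hasDerivAt_const _ _)
  have h22 : (Matrix.of fun j i => (fderiv ℝ (arrowMap t) w (0, Pi.single i 1)).2 j)
      = Matrix.diagonal (fun j => -2 * Q j * σ j / q j) * Uᵀ := by
    ext j i
    rw [Matrix.diagonal_mul, Matrix.of_apply, Matrix.transpose_apply]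
    have hq := h.row_ne_zero hp j
    have hσ := h.sv_ne_zero hp j
    -- `arrowPoly` is `s Q(s) - ∑ aᵢ² cᵢ` with `cᵢ` independent of `a`
    let c : Fin (m + 1) → ℝ := Fin.snoc (α := fun _ => ℝ)
      (fun k => t j * sqProdErase (toParams w).2 k (t j)) (Q j)
    have hder : (fderiv ℝ (arrowMap t) w (0, Pi.single i 1)).2 j = -(2 * w.2 i * c i) := by
      refine fderiv_snd_apply_eq hd ?_
      have := (hasDerivAt_sum_sq_mul w.2 c i).const_sub (t j * Q j)
      refine this.congr_of_eventuallyEq (Filter.Eventually.of_forall fun s => ?_)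
      simp only [arrowMap, arrowPoly, Fin.sum_univ_castSucc, c, Fin.snoc_castSucc, Fin.snoc_last,
        Finset.mul_sum, toParams, Q]
      simp only [Prod.snd_add, Prod.smul_snd, Prod.fst_add, Prod.smul_fst, smul_zero, add_zero]
      rw [sub_sub, add_comm (_ * sqProd _ _)]
      congr 2
      exact Finset.sum_congr rfl fun k _ => by ring
    rw [hder]
    induction i using Fin.lastCases with
    | last =>
      simp only [c, Fin.snoc_last]
      rw [h.left_last_eq hp]
      change _ = _ * (_ * (w.2 (Fin.last m) / _))
      field_simp
    | cast k =>
      have hs := h.sv_sq_ne hp j k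
      simp only [c, Fin.snoc_castSucc]
      rw [sqProdErase_eq_div hs, h.left_eq hp]
      change _ = _ * (_ * (w.2 k.castSucc * _ / _))
      simp only [Q, t]
      field_simp
  rw [ContinuousLinearMap.det, linearMap_det_prod]
  simp only [ContinuousLinearMap.coe_coe, h11, h12, h22]
  have h0 : (Matrix.of fun (_ _ : Fin (m + 1)) => (0 : ℝ)) = 0 := rfl
  rw [h0, Matrix.det_fromBlocks_zero₁₂, Matrix.det_mul, Matrix.det_mul, Matrix.det_mul,
    Matrix.det_transpose, Matrix.det_transpose, Matrix.det_diagonal, Matrix.det_diagonal,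
    Matrix.det_diagonal, abs_mul, abs_mul, abs_mul, abs_mul,
    abs_det_of_mem_orthogonalGroup h.orthU, abs_det_of_mem_orthogonalGroup h.orthV, mul_one,
    mul_one, mul_right_comm, Finset.abs_prod, Finset.abs_prod, ← Finset.prod_mul_distrib]
  congr 1
  · refine Finset.prod_congr rfl fun j _ => ?_
    have hq := h.row_ne_zero hp j
    have hQ : Q j = q j ^ 2 * sqProdErase σ j (σ j ^ 2) := h.sqProd_sq hp j
    rw [← abs_mul, hQ]
    have : 2 * (q j ^ 2 * sqProdErase σ j (σ j ^ 2)) / q j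
        * (-2 * (q j ^ 2 * sqProdErase σ j (σ j ^ 2)) * σ j / q j)
        = -(σ j * (4 * q j ^ 2 * sqProdErase σ j (σ j ^ 2) ^ 2)) := by
      field_simp
      ring
    rw [this, abs_neg, abs_mul, abs_of_nonneg (by positivity : (0 : ℝ) ≤ 4 * q j ^ 2 * _)]
    ring
  · rw [Fin.prod_univ_castSucc]
    simp only [Fin.snoc_castSucc, Fin.snoc_last]
    rw [Finset.prod_div_distrib, abs_mul, abs_div, Finset.abs_prod, Finset.abs_prod]
    simp only [abs_neg, abs_pow, Finset.prod_const, Finset.card_univ, Fintype.card_fin]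
    ring

end System

/-! ### The cone over the map to singular data -/

/-- A solution of `Ψ ∘ G = Φ` is as smooth as the data, if `Ψ` is injective near the values of `G`
and has invertible derivative. -/
lemma contDiffAt_of_comp_eq {E : Type*} [NormedAddCommGroup E] [NormedSpace ℝ E]
    [FiniteDimensional ℝ E] {Φ Ψ G : E → E} {w : E} {O : Set E} (hΨ : ContDiff ℝ 1 Ψ)
    (hΦ : ContDiff ℝ 1 Φ) (hdet : (fderiv ℝ Ψ (G w)).det ≠ 0) (hO : IsOpen O)
    (hinj : Set.InjOn Ψ O) (hmem : ∀ᶠ v in nhds w, G v ∈ O)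
    (heq : ∀ᶠ v in nhds w, Ψ (G v) = Φ v) : ContDiffAt ℝ 1 G w := by
  have hcomplete : CompleteSpace E := FiniteDimensional.complete ℝ E
  have hd : HasFDerivAt Ψ (((fderiv ℝ Ψ (G w)).toContinuousLinearEquivOfDetNeZero hdet :
      E ≃L[ℝ] E) : E →L[ℝ] E) (G w) := by
    rw [ContinuousLinearMap.coe_toContinuousLinearEquivOfDetNeZero]
    exact (hΨ.differentiable one_ne_zero _).hasFDerivAt
  have hw : Ψ (G w) = Φ w := heq.self_of_nhds
  let H := hΨ.contDiffAt.localInverse hd one_ne_zero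
  have hH : ContDiffAt ℝ 1 H (Φ w) := by
    rw [← hw]
    exact hΨ.contDiffAt.to_localInverse hd one_ne_zero
  have hHw : H (Φ w) = G w := by
    rw [← hw]
    exact hΨ.contDiffAt.localInverse_apply_image hd one_ne_zero
  have hHΦ : ContDiffAt ℝ 1 (H ∘ Φ) w := hH.comp w hΦ.contDiffAt
  refine hHΦ.congr_of_eventuallyEq ?_
  have h1 : ∀ᶠ v in nhds w, H (Φ v) ∈ O :=
    hHΦ.continuousAt.preimage_mem_nhds (hO.mem_nhds (by
      rw [Function.comp_apply, hHw]
      exact hmem.self_of_nhds))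
  have h2 : ∀ᶠ v in nhds w, Ψ (H (Φ v)) = Φ v := by
    have := (hΨ.contDiffAt.hasStrictFDerivAt' hd one_ne_zero).eventually_right_inverse
    rw [hw] at this
    exact hΦ.continuous.continuousAt.eventually this
  filter_upwards [h1, h2, hmem, heq] with v hv1 hv2 hv3 hv4
  exact hinj hv3 hv1 (hv4.trans hv2.symm)

section Cone

variable {m : ℕ}

/-- The cone over `g`: in the coordinates `((b, r), a)`, the map to `(r q, σ)`. In contrast to
`g`, it is a map between vector spaces of the same dimension. -/
def coneMap (g : BAParams m → BATarget m) (w : (Fin (m + 1) → ℝ) × (Fin (m + 1) → ℝ)) :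
    (Fin (m + 1) → ℝ) × (Fin (m + 1) → ℝ) :=
  (fun j => w.1 (Fin.last m) * (g (toParams w)).1.1 j, (g (toParams w)).2)

/-- The points `((b, r), a)` with nondegenerate `(a, b)` and `r > 0`. -/
def coneDomain (m : ℕ) : Set ((Fin (m + 1) → ℝ) × (Fin (m + 1) → ℝ)) :=
  {w | toParams w ∈ baDomain m ∧ 0 < w.1 (Fin.last m)}

lemma continuous_toParams : Continuous (toParams (m := m)) := by
  unfold toParams
  fun_prop

lemma isOpen_baDomain (m : ℕ) : IsOpen (baDomain m) := by
  have h : baDomain m = (⋂ i, {p | p.1 i ≠ 0}) ∩ ((⋂ i, {p | p.2 i ≠ 0}) ∩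
      ⋂ i, ⋂ j, {p | i ≠ j → |p.2 i| ≠ |p.2 j|}) := by
    ext p
    simp [baDomain]
  rw [h]
  refine (isOpen_iInter_of_finite fun i => isOpen_ne_fun (by fun_prop) (by fun_prop)).inter
    ((isOpen_iInter_of_finite fun i => isOpen_ne_fun (by fun_prop) (by fun_prop)).inter
      (isOpen_iInter_of_finite fun i => isOpen_iInter_of_finite fun j => ?_))
  by_cases hij : i = j
  · simp [hij]
  · simp only [ne_eq, hij, not_false_eq_true, forall_const]
    exact isOpen_ne_fun (by fun_prop) (by fun_prop)

lemma isOpen_coneDomain (m : ℕ) : IsOpen (coneDomain m) :=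
  ((isOpen_baDomain m).preimage continuous_toParams).inter
    (isOpen_lt continuous_const ((continuous_apply (Fin.last m)).comp continuous_fst))

/-- The positive vectors `x` and the positive, strictly decreasing vectors `σ`. -/
def spectralCone (m : ℕ) : Set ((Fin (m + 1) → ℝ) × (Fin (m + 1) → ℝ)) :=
  {y | (∀ i, 0 < y.1 i) ∧ (∀ i, 0 < y.2 i) ∧ StrictAnti y.2}

lemma isOpen_spectralCone (m : ℕ) : IsOpen (spectralCone m) := by
  have h : spectralCone m = (⋂ i, {y | 0 < y.1 i}) ∩ ((⋂ i, {y | 0 < y.2 i}) ∩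
      ⋂ i, ⋂ j, {y | i < j → y.2 j < y.2 i}) := by
    ext p
    simp [spectralCone, StrictAnti]
  rw [h]
  refine (isOpen_iInter_of_finite fun i => isOpen_lt (by fun_prop) (by fun_prop)).inter
    ((isOpen_iInter_of_finite fun i => isOpen_lt (by fun_prop) (by fun_prop)).inter
      (isOpen_iInter_of_finite fun i => isOpen_iInter_of_finite fun j => ?_))
  by_cases hij : i < j
  · simp only [hij, forall_const]
    exact isOpen_lt (by fun_prop) (by fun_prop)
  · simp [hij]

variable {g : BAParams m → BATarget m} {w : (Fin (m + 1) → ℝ) × (Fin (m + 1) → ℝ)}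

lemma coneMap_mem_spectralCone (hg : ∀ p ∈ baDomain m, IsSingularData p (g p))
    (hw : w ∈ coneDomain m) : coneMap g w ∈ spectralCone m :=
  have h := hg _ hw.1
  ⟨fun j => mul_pos hw.2 (h.row_pos hw.1 j), fun j => h.sv_pos hw.1 j, h.sv_strictAnti hw.1⟩

lemma specMap_coneMap (hg : ∀ p ∈ baDomain m, IsSingularData p (g p)) (hw : w ∈ coneDomain m)
    (t : Fin (m + 1) → ℝ) : specMap t (coneMap g w) = arrowMap t w := by
  obtain ⟨U, V, h⟩ := (hg _ hw.1).exists_isSVD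
  refine Prod.ext (funext fun j => ?_) (funext fun j => (h.arrowPoly_eq hw.1 _).symm)
  simp only [specMap, arrowMap, coneMap, ← h.sqComb_eq hw.1, sqComb, Finset.mul_sum]
  exact Finset.sum_congr rfl fun i _ => by ring

lemma det_fderiv_specMap_coneMap_ne_zero (hg : ∀ p ∈ baDomain m, IsSingularData p (g p))
    (hw : w ∈ coneDomain m) :
    (fderiv ℝ (specMap fun j => (g (toParams w)).2 j ^ 2) (coneMap g w)).det ≠ 0 := by
  have hy := coneMap_mem_spectralCone hg hw
  rw [← abs_ne_zero, coneMap, abs_det_fderiv_specMap, Finset.prod_ne_zero_iff]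
  intro j _
  have h1 := (hy.1 j).ne'
  have h2 := (hy.2.1 j).ne'
  have h3 := sqProdErase_apply_sq_ne_zero ((hg _ hw.1).sv_sq_injective hw.1) j
  simp only [coneMap] at h1 h2
  exact mul_ne_zero (mul_ne_zero (mul_ne_zero four_ne_zero (abs_ne_zero.2 h1))
    (abs_ne_zero.2 h2)) (pow_ne_zero 2 h3)

lemma contDiffAt_coneMap (hg : ∀ p ∈ baDomain m, IsSingularData p (g p))
    (hw : w ∈ coneDomain m) : ContDiffAt ℝ 1 (coneMap g) w := by
  have hev := (isOpen_coneDomain m).mem_nhds hw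
  refine contDiffAt_of_comp_eq (contDiff_specMap fun j => (g (toParams w)).2 j ^ 2)
    (contDiff_arrowMap _) (det_fderiv_specMap_coneMap_ne_zero hg hw) (isOpen_spectralCone m) ?_
    (Filter.eventually_of_mem hev fun v hv => coneMap_mem_spectralCone hg hv)
    (Filter.eventually_of_mem hev fun v hv => specMap_coneMap hg hv _)
  intro y hy z hz hyz
  obtain ⟨h1, h2⟩ := eq_of_sqProd_eq_of_sqComb_eq ((hg _ hw.1).sv_sq_injective hw.1) hy.1 hz.1
    hy.2.1 hz.2.1 hy.2.2 hz.2.2 (fun j => congrFun (congrArg Prod.fst hyz) j)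
    (fun j => congrFun (congrArg Prod.snd hyz) j)
  exact Prod.ext h1 h2

lemma abs_det_fderiv_coneMap (hg : ∀ p ∈ baDomain m, IsSingularData p (g p))
    (hw : w ∈ coneDomain m) :
    |(fderiv ℝ (coneMap g) w).det| = w.1 (Fin.last m) ^ m * baDensity g (toParams w) := by
  obtain ⟨U, V, h⟩ := (hg _ hw.1).exists_isSVD
  set t : Fin (m + 1) → ℝ := fun j => (g (toParams w)).2 j ^ 2 with ht
  set r := w.1 (Fin.last m)
  have hr : 0 < r := hw.2
  have hcomp : (specMap t) ∘ (coneMap g) =ᶠ[nhds w] arrowMap t :=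
    Filter.eventually_of_mem ((isOpen_coneDomain m).mem_nhds hw) fun v hv => specMap_coneMap hg hv _
  have hchain : (fderiv ℝ (specMap t) (coneMap g w)).comp (fderiv ℝ (coneMap g) w)
      = fderiv ℝ (arrowMap t) w := by
    rw [← hcomp.fderiv_eq]
    exact (fderiv_comp w ((contDiff_specMap t).differentiable one_ne_zero _)
      ((contDiffAt_coneMap hg hw).differentiableAt one_ne_zero)).symm
  have hdet : |(fderiv ℝ (specMap t) (coneMap g w)).det| * |(fderiv ℝ (coneMap g) w).det|
      = |(fderiv ℝ (arrowMap t) w).det| := by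
    rw [← hchain, ← abs_mul]
    congr 1
    exact (LinearMap.det_comp _ _).symm
  have hne := abs_ne_zero.2 (det_fderiv_specMap_coneMap_ne_zero hg hw)
  rw [h.abs_det_fderiv_arrowMap hw.1] at hdet
  refine mul_left_cancel₀ hne (hdet.trans ?_)
  rw [coneMap, abs_det_fderiv_specMap, baDensity]
  have hq (j) : 0 < (g (toParams w)).1.1 j := (hg _ hw.1).row_pos hw.1 j
  simp only [abs_mul, abs_of_pos (hq _)]
  change _ * (|r| ^ _ / _) = _
  rw [abs_of_pos hr]
  simp only [Finset.prod_mul_distrib, Finset.prod_const, Finset.card_univ, Fintype.card_fin,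
    Finset.prod_pow, toParams]
  ring

end Cone

/-! ### Smoothness and the Jacobian -/

section Jacobian

variable {m : ℕ}

/-- The linear inclusion `(a, b) ↦ ((b, 0), a)`. -/
noncomputable def paramsIncl (m : ℕ) :
    BAParams m →L[ℝ] (Fin (m + 1) → ℝ) × (Fin (m + 1) → ℝ) :=
  LinearMap.toContinuousLinearMap
    { toFun := fun p => (Fin.snoc (α := fun _ => ℝ) p.2 0, p.1)
      map_add' := fun p p' => by
        refine Prod.ext (funext fun i => ?_) rfl
        induction i using Fin.lastCases <;> simp
      map_smul' := fun c p => by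
        refine Prod.ext (funext fun i => ?_) rfl
        induction i using Fin.lastCases <;> simp }

lemma paramsIncl_apply (p : BAParams m) :
    paramsIncl m p = (Fin.snoc (α := fun _ => ℝ) p.2 0, p.1) := rfl

/-- The inclusion `(a, b) ↦ ((b, 1), a)` of the parameters in the coordinates of the cone. -/
noncomputable def unitSection (p : BAParams m) : (Fin (m + 1) → ℝ) × (Fin (m + 1) → ℝ) :=
  paramsIncl m p + (Pi.single (Fin.last m) 1, 0)

lemma unitSection_last (p : BAParams m) : (unitSection p).1 (Fin.last m) = 1 := by
  simp [unitSection, paramsIncl_apply]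

lemma toParams_unitSection (p : BAParams m) : toParams (unitSection p) = p := by
  refine Prod.ext ?_ (funext fun k => ?_) <;> simp [unitSection, paramsIncl_apply, toParams]

lemma unitSection_mem {p : BAParams m} (hp : p ∈ baDomain m) : unitSection p ∈ coneDomain m :=
  ⟨(toParams_unitSection p).symm ▸ hp, (unitSection_last p).symm ▸ one_pos⟩

lemma hasFDerivAt_unitSection (p : BAParams m) :
    HasFDerivAt unitSection (paramsIncl m) p :=
  (paramsIncl m).hasFDerivAt.add_const _

/-- The identification of `ℝⁿ × ℝⁿ` with its Euclidean first factor. -/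
noncomputable def euclideanFst (m : ℕ) : (Fin (m + 1) → ℝ) × (Fin (m + 1) → ℝ) →L[ℝ]
    EuclideanSpace ℝ (Fin (m + 1)) × (Fin (m + 1) → ℝ) :=
  ((EuclideanSpace.equiv (Fin (m + 1)) ℝ).symm : (Fin (m + 1) → ℝ) →L[ℝ] _).prodMap
    (ContinuousLinearMap.id ℝ _)

lemma ambientMap_eq (g : BAParams m → BATarget m) :
    ambientMap g = euclideanFst m ∘ coneMap g ∘ unitSection := by
  funext p
  refine Prod.ext ?_ ?_
  · ext k
    simp [ambientMap, euclideanFst, coneMap, unitSection_last, toParams_unitSection]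
  · simp [ambientMap, euclideanFst, coneMap, toParams_unitSection]

variable {g : BAParams m → BATarget m} {p : BAParams m}

lemma contDiffAt_ambientMap (hg : ∀ p ∈ baDomain m, IsSingularData p (g p))
    (hp : p ∈ baDomain m) : ContDiffAt ℝ 1 (ambientMap g) p := by
  rw [ambientMap_eq]
  refine (euclideanFst m).contDiff.contDiffAt.comp p
    ((contDiffAt_coneMap hg (unitSection_mem hp)).comp p ?_)
  exact ((paramsIncl m).contDiff.add contDiff_const).contDiffAt

lemma fderiv_ambientMap (hg : ∀ p ∈ baDomain m, IsSingularData p (g p))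
    (hp : p ∈ baDomain m) (e : BAParams m) : fderiv ℝ (ambientMap g) p e
      = euclideanFst m (fderiv ℝ (coneMap g) (unitSection p) (paramsIncl m e)) := by
  rw [ambientMap_eq]
  have h1 := ((contDiffAt_coneMap hg (unitSection_mem hp)).differentiableAt one_ne_zero).hasFDerivAt
  have h2 := (euclideanFst m).hasFDerivAt.comp p (h1.comp p (hasFDerivAt_unitSection p))
  rw [h2.fderiv]
  rfl

lemma sum_sq_sphere_row (g : BAParams m → BATarget m) (p : BAParams m) :
    ∑ k, (g p).1.1 k ^ 2 = 1 := by
  have h := mem_sphere_zero_iff_norm.1 (g p).1.2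
  have h2 := EuclideanSpace.norm_sq_eq (g p).1.1
  rw [h, one_pow] at h2
  simpa using h2.symm

/-- As `q` moves on the unit sphere, its derivative is orthogonal to `q`. -/
lemma sum_mul_fderiv_ambientMap (hg : ∀ p ∈ baDomain m, IsSingularData p (g p))
    (hp : p ∈ baDomain m) (e : BAParams m) :
    ∑ k, (g p).1.1 k * (fderiv ℝ (ambientMap g) p e).1 k = 0 := by
  have hd := (contDiffAt_ambientMap hg hp).differentiableAt one_ne_zero
  have h1 := hd.hasFDerivAt.hasLineDerivAt e
  have h2 (k : Fin (m + 1)) := ((EuclideanSpace.proj k :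
    EuclideanSpace ℝ (Fin (m + 1)) →L[ℝ] ℝ).comp
    (ContinuousLinearMap.fst ℝ (EuclideanSpace ℝ (Fin (m + 1)))
      (Fin (m + 1) → ℝ))).hasFDerivAt.comp_hasDerivAt (0 : ℝ) h1
  have h3 := HasDerivAt.fun_sum (u := Finset.univ) fun k (_ : k ∈ Finset.univ) => (h2 k).fun_pow 2
  have h4 : HasDerivAt (fun _ : ℝ => (1 : ℝ)) 0 0 := hasDerivAt_const _ _
  have h5 := (h3.congr_of_eventuallyEq (Filter.Eventually.of_forall fun s =>
    (sum_sq_sphere_row g (p + s • e)).symm)).unique h4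
  simp only [Nat.cast_ofNat, Nat.add_one_sub_one, pow_one, mul_assoc, ← Finset.mul_sum] at h5
  have h6 := (mul_eq_zero.1 h5).resolve_left two_ne_zero
  simpa [ambientMap] using h6

/-- The Jacobian matrix of the cone over `g` at radius `1`. -/
noncomputable def conePartials (g : BAParams m → BATarget m) (p : BAParams m) :
    Matrix (Fin (m + 1) ⊕ Fin (m + 1)) (Fin (m + 1) ⊕ Fin (m + 1)) ℝ :=
  Matrix.of fun i j =>
    let w := fderiv ℝ (coneMap g) (unitSection p)
      (Sum.elim (fun k => (Pi.single k 1, 0)) (fun k => (0, Pi.single k 1)) j)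
    Sum.elim (fun k => w.1 k) (fun k => w.2 k) i

lemma det_conePartials (g : BAParams m → BATarget m) (p : BAParams m) :
    (conePartials g p).det = (fderiv ℝ (coneMap g) (unitSection p)).det := by
  rw [ContinuousLinearMap.det, linearMap_det_prod]
  congr 1
  ext (i | i) (j | j) <;> rfl

/-- The columns of `∂(q, σ) / ∂(a, b)`, followed by the radial one, as columns of the Jacobian
matrix of the cone. -/
def conePartialsIndex (m : ℕ) :
    (Fin (m + 1) ⊕ Fin m) ⊕ Unit ≃ Fin (m + 1) ⊕ Fin (m + 1) :=
  ((Equiv.sumAssoc _ _ _).trans (Equiv.sumCongr (Equiv.refl _)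
    ((Equiv.optionEquivSumPUnit _).symm.trans finSuccEquivLast.symm))).trans (Equiv.sumComm _ _)

lemma conePartials_inr (hg : ∀ p ∈ baDomain m, IsSingularData p (g p)) (hp : p ∈ baDomain m)
    (i : Fin (m + 1) ⊕ Fin (m + 1)) (k : Fin (m + 1)) :
    conePartials g p i (Sum.inr k) = partialsMatrix g p i (Sum.inl k) := by
  have h : paramsIncl m (Pi.single k 1, 0) = (0, Pi.single k 1) := by
    refine Prod.ext (funext fun i => ?_) rfl
    induction i using Fin.lastCases <;> simp [paramsIncl_apply]
  rcases i with i | i <;>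
    simp [conePartials, partialsMatrix, fderiv_ambientMap hg hp, h, euclideanFst]

lemma conePartials_inl_castSucc (hg : ∀ p ∈ baDomain m, IsSingularData p (g p))
    (hp : p ∈ baDomain m) (i : Fin (m + 1) ⊕ Fin (m + 1)) (k : Fin m) :
    conePartials g p i (Sum.inl k.castSucc) = partialsMatrix g p i (Sum.inr k) := by
  have h : paramsIncl m (0, Pi.single k 1) = (Pi.single k.castSucc 1, 0) := by
    refine Prod.ext (funext fun i => ?_) rfl
    induction i using Fin.lastCases with
    | last => simp [paramsIncl_apply, (Fin.castSucc_lt_last k).ne']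
    | cast l => simp [paramsIncl_apply, Pi.single_apply]
  rcases i with i | i <;>
    simp [conePartials, partialsMatrix, fderiv_ambientMap hg hp, h, euclideanFst]

lemma conePartials_inl_last (hg : ∀ p ∈ baDomain m, IsSingularData p (g p))
    (hp : p ∈ baDomain m) (i : Fin (m + 1) ⊕ Fin (m + 1)) :
    conePartials g p i (Sum.inl (Fin.last m)) = Sum.elim (fun k => (g p).1.1 k) 0 i := by
  have hd := (contDiffAt_coneMap hg (unitSection_mem hp)).differentiableAt one_ne_zero
  have h (s : ℝ) : toParams (unitSection p + (s • Pi.single (Fin.last m) 1,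
      (0 : Fin (m + 1) → ℝ))) = p := by
    refine Prod.ext ?_ (funext fun k => ?_) <;> simp [unitSection, paramsIncl_apply, toParams]
  rcases i with i | i
  · refine fderiv_fst_apply_eq hd ?_
    have := (((hasDerivAt_id (0 : ℝ)).const_add 1).mul_const ((g p).1.1 i))
    simpa [coneMap, unitSection_last, h] using this
  · refine fderiv_snd_apply_eq hd ?_
    simpa [coneMap, h] using hasDerivAt_const (0 : ℝ) ((g p).2 i)

/-- The radial column of the Jacobian matrix of the cone is the unit vector `(q, 0)`, and it is
orthogonal to the others. -/
lemma gram_conePartials (hg : ∀ p ∈ baDomain m, IsSingularData p (g p)) (hp : p ∈ baDomain m) :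
    ((conePartials g p)ᵀ * conePartials g p).submatrix (conePartialsIndex m) (conePartialsIndex m)
      = Matrix.fromBlocks ((partialsMatrix g p)ᵀ * partialsMatrix g p) 0 0 1 := by
  have h1 (i) (c : Fin (m + 1) ⊕ Fin m) : conePartials g p i (conePartialsIndex m (Sum.inl c))
      = partialsMatrix g p i c := by
    rcases c with k | k
    · simpa [conePartialsIndex] using conePartials_inr hg hp i k
    · simpa [conePartialsIndex] using conePartials_inl_castSucc hg hp i k
  have h2 (i) (u : Unit) : conePartials g p i (conePartialsIndex m (Sum.inr u))
      = Sum.elim (fun k => (g p).1.1 k) 0 i := by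
    simpa [conePartialsIndex] using conePartials_inl_last hg hp i
  have h3 (c) : ∑ k, (g p).1.1 k * partialsMatrix g p (Sum.inl k) c = 0 :=
    sum_mul_fderiv_ambientMap hg hp _
  have h4 := sum_sq_sphere_row g p
  ext (c | u) (d | v)
  · simp [Matrix.mul_apply, h1]
  · simpa [Matrix.mul_apply, h1, h2, mul_comm] using h3 c
  · simpa [Matrix.mul_apply, h1, h2] using h3 d
  · simpa [Matrix.mul_apply, h2, ← sq] using h4

lemma jacobianFactor_eq (hg : ∀ p ∈ baDomain m, IsSingularData p (g p)) (hp : p ∈ baDomain m) :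
    jacobianFactor g p = baDensity g p := by
  have h1 : ((partialsMatrix g p)ᵀ * partialsMatrix g p).det = (conePartials g p).det ^ 2 := by
    have := congrArg Matrix.det (gram_conePartials hg hp)
    rw [Matrix.det_submatrix_equiv_self, Matrix.det_fromBlocks_zero₂₁, Matrix.det_one, mul_one,
      Matrix.det_mul, Matrix.det_transpose] at this
    rw [← this, sq]
  rw [jacobianFactor, h1, Real.sqrt_sq_eq_abs, det_conePartials,
    abs_det_fderiv_coneMap hg (unitSection_mem hp), unitSection_last, toParams_unitSection,
    one_pow, one_mul]

end Jacobian

/-! ### The image measure -/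

section Measure

variable {m : ℕ}

/-- The coordinates `((b, r), a)`, rearranged as `(r, (a, b))`. -/
noncomputable def radiusParams (m : ℕ) :
    (Fin (m + 1) → ℝ) × (Fin (m + 1) → ℝ) ≃ᵐ ℝ × BAParams m :=
  ((MeasurableEquiv.prodCongr (MeasurableEquiv.piFinSuccAbove (fun _ => ℝ) (Fin.last m))
    (MeasurableEquiv.refl _)).trans MeasurableEquiv.prodAssoc).trans
      (MeasurableEquiv.prodCongr (MeasurableEquiv.refl _) MeasurableEquiv.prodComm)

lemma radiusParams_apply (w : (Fin (m + 1) → ℝ) × (Fin (m + 1) → ℝ)) :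
    radiusParams m w = (w.1 (Fin.last m), toParams w) := by
  refine Prod.ext rfl (Prod.ext rfl (funext fun k => ?_))
  change w.1 ((Fin.last m).succAbove k) = w.1 k.castSucc
  rw [Fin.succAbove_last]

lemma measurePreserving_radiusParams (m : ℕ) :
    MeasurePreserving (radiusParams m) volume volume := by
  have h1 : MeasurePreserving (MeasurableEquiv.prodCongr
      (MeasurableEquiv.piFinSuccAbove (fun _ => ℝ) (Fin.last m))
      (MeasurableEquiv.refl (Fin (m + 1) → ℝ))) volume volume :=
    (volume_preserving_piFinSuccAbove (fun _ => ℝ) (Fin.last m)).prod (MeasurePreserving.id volume)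
  have h2 : MeasurePreserving (MeasurableEquiv.prodCongr (MeasurableEquiv.refl ℝ)
      (MeasurableEquiv.prodComm (α := Fin m → ℝ) (β := Fin (m + 1) → ℝ))) volume volume :=
    (MeasurePreserving.id volume).prod Measure.measurePreserving_swap
  exact h2.comp (volume_preserving_prodAssoc.comp h1)

lemma exists_radius_params (r : ℝ) (p : BAParams m) :
    ∃ w : (Fin (m + 1) → ℝ) × (Fin (m + 1) → ℝ), w.1 (Fin.last m) = r ∧ toParams w = p := by
  have h := (radiusParams m).apply_symm_apply (r, p)
  rw [radiusParams_apply, Prod.mk.injEq] at h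
  exact ⟨_, h⟩

/-- Polar coordinates are unique. -/
lemma eq_of_mul_eq_mul {q q' : Metric.sphere (0 : EuclideanSpace ℝ (Fin (m + 1))) 1} {r r' : ℝ}
    (hr : 0 < r) (hr' : 0 < r') (h : ∀ j, r * q.1 j = r' * q'.1 j) : r = r' ∧ q = q' := by
  have h1 : r • q.1 = r' • q'.1 := by
    ext j
    simpa using h j
  have h2 := congrArg norm h1
  rw [norm_smul, norm_smul, mem_sphere_zero_iff_norm.1 q.2, mem_sphere_zero_iff_norm.1 q'.2,
    mul_one, mul_one, Real.norm_of_nonneg hr.le, Real.norm_of_nonneg hr'.le] at h2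
  subst h2
  exact ⟨rfl, Subtype.ext (smul_right_injective _ hr.ne' h1)⟩

/-- The points `((b, r), a)` with `0 < r < 1` and `(a, b) ∈ S`. -/
def truncatedCone (S : Set (BAParams m)) : Set ((Fin (m + 1) → ℝ) × (Fin (m + 1) → ℝ)) :=
  radiusParams m ⁻¹' (Set.Ioo 0 1 ×ˢ S)

lemma mem_truncatedCone {S : Set (BAParams m)} {w : (Fin (m + 1) → ℝ) × (Fin (m + 1) → ℝ)} :
    w ∈ truncatedCone S ↔ (0 < w.1 (Fin.last m) ∧ w.1 (Fin.last m) < 1) ∧ toParams w ∈ S := by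
  simp [truncatedCone, radiusParams_apply]

lemma lintegral_Ioo_pow (m : ℕ) :
    ∫⁻ r in Set.Ioo (0 : ℝ) 1, ENNReal.ofReal (r ^ m) = ((m + 1 : ℕ) : ENNReal)⁻¹ := by
  rw [Measure.restrict_congr_set Ioo_ae_eq_Ioc,
    ← ofReal_integral_eq_lintegral_ofReal (intervalIntegral.intervalIntegrable_pow _).1,
    ← intervalIntegral.integral_of_le zero_le_one]
  · rw [integral_pow, one_pow, zero_pow m.succ_ne_zero, sub_zero, one_div,
      ENNReal.ofReal_inv_of_pos (by positivity)]
    congr 1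
    exact_mod_cast ENNReal.ofReal_natCast (m + 1)
  · filter_upwards [ae_restrict_mem measurableSet_Ioc] with y hy
    exact pow_nonneg hy.1.le _

variable {g : BAParams m → BATarget m} {S : Set (BAParams m)}

lemma truncatedCone_subset (hS : S ⊆ baDomain m) : truncatedCone S ⊆ coneDomain m :=
  fun _ hw => ⟨hS (mem_truncatedCone.1 hw).2, (mem_truncatedCone.1 hw).1.1⟩

lemma injOn_coneMap (hinj : Set.InjOn g S) : Set.InjOn (coneMap g) (truncatedCone S) := by
  intro v hv w hw hvw
  rw [mem_truncatedCone] at hv hw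
  obtain ⟨h1, h2⟩ := eq_of_mul_eq_mul hv.1.1 hw.1.1
    fun j => congrFun (congrArg Prod.fst hvw) j
  have h3 := hinj hv.2 hw.2 (Prod.ext h2 (congrArg (fun y => y.2) hvw :))
  exact (radiusParams m).injective (by rw [radiusParams_apply, radiusParams_apply, h1, h3])

lemma mem_image_coneMap {x σ : Fin (m + 1) → ℝ} :
    (x, σ) ∈ coneMap g '' truncatedCone S ↔
      ∃ r ∈ Set.Ioo (0 : ℝ) 1, ∃ q, (q, σ) ∈ g '' S ∧ ∀ j, r * q.1 j = x j := by
  constructor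
  · rintro ⟨w, hw, hwx⟩
    rw [mem_truncatedCone] at hw
    exact ⟨_, hw.1, (g (toParams w)).1, ⟨_, hw.2, Prod.ext rfl (congrArg (fun y => y.2) hwx :)⟩,
      fun j => congrFun (congrArg Prod.fst hwx) j⟩
  · rintro ⟨r, hr, q, ⟨p, hp, hpq⟩, hx⟩
    obtain ⟨w, hw1, hw2⟩ := exists_radius_params r p
    refine ⟨w, mem_truncatedCone.2 ⟨hw1 ▸ hr, hw2 ▸ hp⟩, ?_⟩
    simp only [coneMap, hw1, hw2, hpq, hx]

lemma measurableSet_truncatedCone (hSm : MeasurableSet S) : MeasurableSet (truncatedCone S) :=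
  (radiusParams m).measurable (measurableSet_Ioo.prod hSm)

lemma measurableSet_image_coneMap (hg : ∀ p ∈ baDomain m, IsSingularData p (g p))
    (hSm : MeasurableSet S) (hS : S ⊆ baDomain m) (hinj : Set.InjOn g S) :
    MeasurableSet (coneMap g '' truncatedCone S) :=
  (measurableSet_truncatedCone hSm).image_of_continuousOn_injOn
    (fun _ hw => (contDiffAt_coneMap hg
      (truncatedCone_subset hS hw)).continuousAt.continuousWithinAt) (injOn_coneMap hinj)

lemma measurableSet_image (hg : ∀ p ∈ baDomain m, IsSingularData p (g p))
    (hSm : MeasurableSet S) (hS : S ⊆ baDomain m) (hinj : Set.InjOn g S) :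
    MeasurableSet (g '' S) := by
  -- `g '' S` is the section of the truncated cone at radius `1 / 2`
  have h : g '' S = (fun y : BATarget m => ((fun j => 2⁻¹ * y.1.1 j, y.2) :
      (Fin (m + 1) → ℝ) × (Fin (m + 1) → ℝ))) ⁻¹' (coneMap g '' truncatedCone S) := by
    ext ⟨q, σ⟩
    rw [Set.mem_preimage, mem_image_coneMap]
    constructor
    · intro h
      exact ⟨2⁻¹, ⟨by norm_num, by norm_num⟩, q, h, fun j => rfl⟩
    · rintro ⟨r, hr, q', h, hq⟩
      obtain rfl := (eq_of_mul_eq_mul hr.1 (by norm_num) hq).2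
      exact h
  rw [h]
  exact (by fun_prop : Continuous _).measurable (measurableSet_image_coneMap hg hSm hS hinj)

/-- Integration of the cone over `g '' S` in polar coordinates. -/
lemma dqdσ_image (hg : ∀ p ∈ baDomain m, IsSingularData p (g p))
    (hSm : MeasurableSet S) (hS : S ⊆ baDomain m) (hinj : Set.InjOn g S) :
    dqdσ m (g '' S) = (m + 1 : ℕ) * volume (coneMap g '' truncatedCone S) := by
  have hC := measurableSet_image_coneMap hg hSm hS hinj
  have hT := measurableSet_image hg hSm hS hinj
  rw [dqdσ, Measure.prod_apply_symm hT, Measure.volume_eq_prod, Measure.prod_apply_symm hC,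
    ← lintegral_const_mul' _ _ (ENNReal.natCast_ne_top _)]
  refine lintegral_congr fun σ => ?_
  rw [Measure.toSphere_apply' _ (measurable_prodMk_right hT), finrank_euclideanSpace,
    Fintype.card_fin, ← (PiLp.volume_preserving_ofLp (Fin (m + 1))).measure_preimage
      (measurable_prodMk_right hC).nullMeasurableSet]
  congr 2
  ext x
  rw [Set.mem_preimage, Set.mem_preimage, mem_image_coneMap]
  simp only [Set.mem_smul, Set.mem_image]
  constructor
  · rintro ⟨r, hr, _, ⟨q, hq, rfl⟩, rfl⟩
    exact ⟨r, hr, q, hq, fun j => rfl⟩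
  · rintro ⟨r, hr, q, hq, hx⟩
    exact ⟨r, hr, _, ⟨q, hq, rfl⟩, by ext j; exact hx j⟩

lemma continuousOn_baDensity (hg : ∀ p ∈ baDomain m, IsSingularData p (g p)) :
    ContinuousOn (baDensity g) (baDomain m) := by
  have h : ContinuousOn (ambientMap g) (baDomain m) := fun p hp =>
    (contDiffAt_ambientMap hg hp).continuousAt.continuousWithinAt
  refine ContinuousOn.div (continuousOn_finsetProd _ fun k _ => ?_) (by fun_prop)
    fun p hp => Finset.prod_ne_zero_iff.2 fun i _ => abs_ne_zero.2 (hp.1 _)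
  exact (by fun_prop : Continuous fun y : EuclideanSpace ℝ (Fin (m + 1)) ×
    (Fin (m + 1) → ℝ) => y.1 k).comp_continuousOn h

lemma volume_image_coneMap (hg : ∀ p ∈ baDomain m, IsSingularData p (g p))
    (hSm : MeasurableSet S) (hS : S ⊆ baDomain m) (hinj : Set.InjOn g S) :
    volume (coneMap g '' truncatedCone S)
      = ((m + 1 : ℕ) : ENNReal)⁻¹ * ∫⁻ p in S, ENNReal.ofReal (baDensity g p) := by
  have hm := measurableSet_truncatedCone (m := m) hSm
  have hHaar : (volume : Measure ((Fin (m + 1) → ℝ) × (Fin (m + 1) → ℝ))).IsAddHaarMeasure :=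
    Measure.prod.instIsAddHaarMeasure _ _
  rw [← lintegral_abs_det_fderiv_eq_addHaar_image volume hm (fun w hw =>
    ((contDiffAt_coneMap hg (truncatedCone_subset hS hw)).differentiableAt
      one_ne_zero).hasFDerivAt.hasFDerivWithinAt) (injOn_coneMap hinj)]
  have h1 : ∫⁻ w in truncatedCone S, ENNReal.ofReal |(fderiv ℝ (coneMap g) w).det|
      = ∫⁻ w in truncatedCone S, ENNReal.ofReal ((radiusParams m w).1 ^ m)
        * ENNReal.ofReal (baDensity g (radiusParams m w).2) := by
    refine setLIntegral_congr_fun hm fun w hw => ?_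
    simp only [radiusParams_apply]
    rw [abs_det_fderiv_coneMap hg (truncatedCone_subset hS hw),
      ENNReal.ofReal_mul (pow_nonneg (mem_truncatedCone.1 hw).1.1.le _)]
  rw [h1]
  refine ((measurePreserving_radiusParams m).setLIntegral_comp_preimage_emb
    (radiusParams m).measurableEmbedding (fun z : ℝ × BAParams m => ENNReal.ofReal (z.1 ^ m)
      * ENNReal.ofReal (baDensity g z.2)) (Set.Ioo 0 1 ×ˢ S)).trans ?_
  rw [Measure.volume_eq_prod, ← Measure.prod_restrict]
  refine (lintegral_prod_mul (f := fun r : ℝ => ENNReal.ofReal (r ^ m))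
    (g := fun p => ENNReal.ofReal (baDensity g p)) ?_ ?_).trans ?_
  · exact (by fun_prop : Measurable fun r : ℝ => ENNReal.ofReal (r ^ m)).aemeasurable
  · exact (((continuousOn_baDensity hg).mono hS).aemeasurable hSm).ennreal_ofReal
  · rw [lintegral_Ioo_pow]

end Measure

theorem lemma2 (m : ℕ) :
    (∀ p ∈ baDomain m, ∃! y : BATarget m, IsSingularData p y) ∧
    ∀ g : BAParams m → BATarget m, (∀ p ∈ baDomain m, IsSingularData p (g p)) →
      ContDiffOn ℝ 1 (ambientMap g) (baDomain m) ∧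
      (∀ p ∈ baDomain m, jacobianFactor g p = baDensity g p) ∧
      (∀ S : Set (BAParams m), MeasurableSet S → S ⊆ baDomain m → Set.InjOn g S →
        dqdσ m (g '' S) = ∫⁻ p in S, ENNReal.ofReal (baDensity g p)) := by
  refine ⟨fun p hp => ?_, fun g hg => ⟨fun p hp => (contDiffAt_ambientMap hg hp).contDiffWithinAt,
    fun p hp => jacobianFactor_eq hg hp, fun S hSm hS hinj => ?_⟩⟩
  · obtain ⟨y, hy⟩ := exists_isSingularData hp
    exact ⟨y, hy, fun y' hy' => hy'.unique hp hy⟩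
  · rw [dqdσ_image hg hSm hS hinj, volume_image_coneMap hg hSm hS hinj, ← mul_assoc,
      ENNReal.mul_inv_cancel (by simp) (ENNReal.natCast_ne_top _), one_mul]
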